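/- **Lemma 4.1.** Consider the following randomized algorithm. The input is a metric $w$ on a finite set $V$ of $n\ge 2$ points with $1\le w(u,v)\le W$ for all $u\ne v$, viewed as a complete weighted graph $G$ on $V$. The parameters are reals $\alpha>1$, $c>0$, $\epsilon\in(0,1]$ and integers $r_1,r_2\ge 0$. For $t>0$ and a partition $\mathcal P$ of $V$, let $G_{\le t}[\mathcal P]$ be the graph of all edges of weight at most $t$ whose endpoints lie in the same set of $\mathcal P$. The levels are $t=\alpha^0,\alpha^1,\dots,\alpha^K$, where $K\ge 0$ is the least integer with $\alpha^K\ge W$. Components are sets of vertices; edges have distinct IDs, used to break ties. 1. *MPX decompositions.* For each level $t$ independently, draw independent exponential delays $\delta_v$ ($v\in V$) with rate $c\log n/t$, assign each $u$ to a center $v$ minimizing $w(u,v)-\delta_v$, and let $\mathcal P^0_t$ be the partition into sets of vertices with the same center. Let $u,v$ be in the same set of $\mathcal P^{\mathrm{MPX}}_{\alpha^k}$ iff they are in the same set of $\mathcal P^0_{\alpha^i}$ for all $k\le i\le K$. In particular $\mathcal P^{\mathrm{MPX}}_{\alpha^{K+1}}=\{V\}$. 2. *Leader compression.* For each level $t$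 independently, start with the components $\mathcal P^{\mathrm{MPX}}_t$ and do $r_1$ rounds of the following with $E=G_{\le t}[\mathcal P^{\mathrm{MPX}}_{\alpha t}]$: each component flips an independent fair coin in $\{0,1\}$; each component with coin $0$ that has an edge of $E$ to a component with coin $1$ joins one such component (chosen arbitrarily). Afterwards, call a component incomplete if it has an outgoing edge in $E$, and join together all incomplete components that lie in the same set of $\mathcal P^{\mathrm{MPX}}_{\alpha t}$. The result is $\widehat{\mathcal P}_t$. Let $\widehat{\mathcal P}_{1/\alpha}$ be the partition into singletons. 3. *Modified Borůvka.* For each level $t$, start with the components $\widehat{\mathcal P}_{t/\alpha}$ and do $r_2$ rounds of the following with $E=G_{\le\alpha t}[\widehat{\mathcal P}_t]$: each component $C$ flips an independent fair coin and finds its shortest outgoing edge $e_C\in E$ (if any); if the coin of $C$ is $0$ and that of the component $C'$ at the other end of $e_C$ is $1$, then $e_C$ is added to $E^1_t$ and $C$ joins $C'$. Afterwards, inside each set $A$ of $\widehat{\mathcal P}_t$ choose one of the remaining components $C^*$ arbitrarily, and for each other remaining component $C$ in $A$ add to $E^2_t$ an arbitrary edge between $C^*$ and $C$. The output is $T=\bigcup_t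 (E^1_t\cup E^2_t)$. The arbitrary choices may be made by any rule that depends on the current state of the algorithm. *Claim.* Let $a,b\ge 0$ be integers, and suppose $W\le n^a$ and $n^{-b}\le\epsilon\le 1$. There is $c_0>0$ depending only on $a,b$ such that for every constant $c\ge c_0$ there is $A_0>0$ depending only on $a,b,c$, such that for every $A_1\ge A_0$ there is $R_0>0$ depending only on $a,b,c,A_1$, such that the following holds whenever $$A_0\frac{\log^2 n}{\epsilon}\le\alpha\le A_1\frac{\log^2 n}{\epsilon}\qquad\text{and}\qquad r_1,r_2\ge R_0\Big(\log\frac1\epsilon+\log\log n\Big).$$ The output $T$ is always a spanning tree of $G$, and $$\mathbb E[w(T)]\le(1+\epsilon)\,w(\mathrm{MST}(G)),$$ where $w(\mathrm{MST}(G))$ is the minimum total weight of a spanning tree of $G$. -/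

import Mathlib

noncomputable section

namespace MetricMST

/-! The input is a finite metric space `V`, seen as the complete graph on `V` in which the edge
`s(u, v)` has weight `dist u v`.  Vertex partitions are equivalence relations `P : Setoid V`: the
sets of `P` are the elements of `Quotient P`, and `P ≤ Q` says that `P` refines `Q`. -/

section Trees

variable {V : Type*} [Fintype V] [MetricSpace V]

/-- Weight of an edge. -/
def edgeWeight : Sym2 V → ℝ :=
  Sym2.lift ⟨fun u v => dist u v, fun u v => dist_comm u v⟩

/-- Total weight of a set of edges. -/
def weight (T : Finset (Sym2 V)) : ℝ := ∑ e ∈ T, edgeWeight e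

/-- `T` is the edge set of a spanning tree of the complete graph on `V`. -/
def IsSpanningTree (T : Finset (Sym2 V)) : Prop :=
  (∀ e ∈ T, ¬ e.IsDiag) ∧ (SimpleGraph.fromEdgeSet (T : Set (Sym2 V))).IsTree

/-- `T` is a spanning tree of minimum total weight. -/
def IsMinSpanningTree (T : Finset (Sym2 V)) : Prop :=
  IsSpanningTree T ∧ ∀ S : Finset (Sym2 V), IsSpanningTree S → weight T ≤ weight S

end Trees

section MPX

variable {V : Type*} [Fintype V] [Nonempty V] [MetricSpace V]

/-- The centre of `u`: a vertex `v` minimizing the shifted distance `dist u v - δ v`. -/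
def mpxCenter (δ : V → ℝ) (u : V) : V :=
  Classical.choose (Finite.exists_min fun v => dist u v - δ v)

/-- The MPX decomposition with delays `δ`: vertices with the same centre are put together. -/
def mpxDecomposition (δ : V → ℝ) : Setoid V := Setoid.ker (mpxCenter δ)

/-- The nested partitions obtained by intersection: `u` and `v` are together at level `α ^ k` iff
they are together in the MPX decompositions of all levels `α ^ i` with `i ≥ k`, where the levels
are `i = 0, …, K`.  One step above the top level (`k = K + 1`) this is the one-set partition. -/
def mpxHierarchy {K : ℕ} (δ : Fin (K + 1) × V → ℝ) (k : ℕ) : Setoid V :=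
  ⨅ (i : Fin (K + 1)) (_ : k ≤ (i : ℕ)), mpxDecomposition fun v => δ (i, v)

end MPX

section Components

variable {V : Type*} [Fintype V] [MetricSpace V]

/-- `G_{≤ t}[P]`: the edges of weight at most `t` that do not cross the partition `P`. -/
def thresholdGraph (t : ℝ) (P : Setoid V) : SimpleGraph V where
  Adj u v := u ≠ v ∧ dist u v ≤ t ∧ P u v
  symm := ⟨fun u v h => ⟨h.1.symm, by rw [dist_comm]; exact h.2.1, P.symm h.2.2⟩⟩
  loopless := ⟨fun _ h => h.1 rfl⟩

/-- The partition obtained from `P` when each component `C` joins the component `f C`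
(`f C = C` if `C` does not join another one). -/
def contract (P : Setoid V) (f : Quotient P → Quotient P) : Setoid V :=
  Setoid.ker fun v => f (Quotient.mk P v)

/-- The components with coin `1` to which `C` has an edge of `E`. -/
def leaders (E : SimpleGraph V) (P : Setoid V) (x : Quotient P → Bool) (C : Quotient P) :
    Set (Quotient P) :=
  {D | x D = true ∧ ∃ u v, Quotient.mk P u = C ∧ Quotient.mk P v = D ∧ E.Adj u v}

/-- The arbitrary decisions of the algorithm, made as functions of the current state (`k` is the
level and `j` the round). -/
structure Choices (V : Type*) where
  /-- edge IDs, used to break ties between edges of equal weight -/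
  edgeId : Sym2 V → ℕ
  edgeId_injective : Function.Injective edgeId
  /-- the component that `C` joins in a round of leader compression -/
  lead : (k j : ℕ) → (E : SimpleGraph V) → (P : Setoid V) → (Quotient P → Bool) →
    Quotient P → Quotient P
  lead_mem : ∀ k j E P x C, (leaders E P x C).Nonempty → lead k j E P x C ∈ leaders E P x C
  /-- a vertex of the set `A` of the partition `B`; its component (in the partition `Q`) is the one
  to which the other components inside `A` get connected in the end -/
  root : (k : ℕ) → (B Q : Setoid V) → Quotient B → V
  root_mem : ∀ k B Q A, Quotient.mk B (root k B Q A) = A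
  /-- the edge used to connect two components -/
  link : (k : ℕ) → (B Q : Setoid V) → (C D : Quotient Q) → V × V
  link_mem : ∀ k B Q C D,
    Quotient.mk Q (link k B Q C D).1 = C ∧ Quotient.mk Q (link k B Q C D).2 = D

open scoped Classical in
/-- Independent fair coins, one for each component of `P`. -/
def coins (P : Setoid V) : PMF (Quotient P → Bool) := PMF.uniformOfFintype _

/-! ### Leader compression -/

open scoped Classical in
/-- One round of leader compression with coins `x`: a component `C` with coin `0` that has an edge
to a component with coin `1` joins such a component. -/
def leaderStep (σ : Choices V) (k j : ℕ) (E : SimpleGraph V) (P : Setoid V)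
    (x : Quotient P → Bool) : Setoid V :=
  contract P fun C =>
    if x C = false ∧ (leaders E P x C).Nonempty then σ.lead k j E P x C else C

/-- The random partition after a number of rounds of leader compression on `P` using the edges
of `E`. -/
def leaderCompression (σ : Choices V) (k : ℕ) (E : SimpleGraph V) (P : Setoid V) :
    ℕ → PMF (Setoid V)
  | 0 => PMF.pure P
  | j + 1 => (leaderCompression σ k E P j).bind fun Q => (coins Q).map (leaderStep σ k j E Q)

/-- The component of `v` in `Q` is incomplete: it has an outgoing edge in `E`. -/
def Incomplete (E : SimpleGraph V) (Q : Setoid V) (v : V) : Prop :=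
  ∃ u w, Q v u ∧ ¬ Q v w ∧ E.Adj u w

/-- Join all the incomplete components of `Q` that lie in the same set of `R`. -/
def joinIncomplete (E : SimpleGraph V) (R Q : Setoid V) : Setoid V :=
  Q ⊔ Relation.EqvGen.setoid fun u v => Incomplete E Q u ∧ Incomplete E Q v ∧ R u v

/-! ### The modified Borůvka algorithm -/

/-- The edges `(u, v)` of `E` that leave `C`, with `u` in `C`. -/
def outgoing (E : SimpleGraph V) (Q : Setoid V) (C : Quotient Q) : Set (V × V) :=
  {p | E.Adj p.1 p.2 ∧ Quotient.mk Q p.1 = C ∧ Quotient.mk Q p.2 ≠ C}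

/-- `p` is the shortest edge of `E` that leaves `C`, with ties broken by edge ID. -/
def IsShortestOutgoing (σ : Choices V) (E : SimpleGraph V) (Q : Setoid V) (C : Quotient Q)
    (p : V × V) : Prop :=
  p ∈ outgoing E Q C ∧ ∀ q ∈ outgoing E Q C,
    dist p.1 p.2 < dist q.1 q.2 ∨
      (dist p.1 p.2 = dist q.1 q.2 ∧ σ.edgeId s(p.1, p.2) ≤ σ.edgeId s(q.1, q.2))

/-- With coins `x`, the component `C` joins another component through its shortest outgoing
edge `p`. -/
def JoinsVia (σ : Choices V) (E : SimpleGraph V) (Q : Setoid V) (x : Quotient Q → Bool)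
    (C : Quotient Q) (p : V × V) : Prop :=
  IsShortestOutgoing σ E Q C p ∧ x C = false ∧ x (Quotient.mk Q p.2) = true

open scoped Classical in
/-- One round of the modified Borůvka algorithm with coins `x`, on the current components `Q` and
the current output edges `F`. -/
def boruvkaStep (σ : Choices V) (E : SimpleGraph V) (Q : Setoid V) (F : Finset (Sym2 V))
    (x : Quotient Q → Bool) : Setoid V × Finset (Sym2 V) :=
  (contract Q fun C => if h : ∃ p, JoinsVia σ E Q x C p then Quotient.mk Q h.choose.2 else C,
    F ∪ Finset.univ.filter fun e => ∃ C p, JoinsVia σ E Q x C p ∧ e = s(p.1, p.2))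

/-- The random components and output edges after a number of rounds of the modified Borůvka
algorithm with initial components `P` and edges `E`. -/
def boruvka (σ : Choices V) (E : SimpleGraph V) (P : Setoid V) :
    ℕ → PMF (Setoid V × Finset (Sym2 V))
  | 0 => PMF.pure (P, ∅)
  | j + 1 => (boruvka σ E P j).bind fun s => (coins s.1).map (boruvkaStep σ E s.1 s.2)

open scoped Classical in
/-- The edges that connect, inside each set of `B`, one component of `Q` to all the others. -/
def starEdges (σ : Choices V) (k : ℕ) (B Q : Setoid V) : Finset (Sym2 V) :=
  Finset.univ.filter fun e => ∃ v : V,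
    let c := Quotient.mk Q (σ.root k B Q (Quotient.mk B v))
    c ≠ Quotient.mk Q v ∧
      e = s((σ.link k B Q c (Quotient.mk Q v)).1, (σ.link k B Q c (Quotient.mk Q v)).2)

open scoped Classical in
/-- The random edge set found at level `t = α ^ k`, given the partition `A` of the previous level
and the partition `B` of this level: `r` rounds of the modified Borůvka algorithm on `A` using
`G_{≤ α t}[B]`, and then arbitrary connections inside the sets of `B`. -/
def levelEdges (σ : Choices V) (α : ℝ) (r k : ℕ) (A B : Setoid V) : PMF (Finset (Sym2 V)) :=
  (boruvka σ (thresholdGraph (α * α ^ k) B) A r).map fun s => s.2 ∪ starEdges σ k B s.1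

open scoped Classical in
/-- The union of the edge sets of the levels below `α ^ m`, given the hierarchy `H`; here `H (k + 1)`
is the partition of level `α ^ k`, and `H 0` is the partition below level `1`. -/
def buildTree (σ : Choices V) (α : ℝ) (r : ℕ) (H : ℕ → Setoid V) : ℕ → PMF (Finset (Sym2 V))
  | 0 => PMF.pure ∅
  | m + 1 => (buildTree σ α r H m).bind fun T =>
      (levelEdges σ α r m (H m) (H (m + 1))).map fun F => T ∪ F

end Components

/-! ### The whole algorithm -/

section Algorithm

variable {V : Type*} [Fintype V] [Nonempty V] [MetricSpace V]

/-- The random partition of level `t = α ^ k`, given the delays: `r` rounds of leader compression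
on the nested MPX partition of level `t`, using the edges of weight at most `t` that do not cross
the nested MPX partition of level `α t`, and then joining the incomplete components. -/
def levelPartition (σ : Choices V) (α : ℝ) (r : ℕ) {K : ℕ} (δ : Fin (K + 1) × V → ℝ) (k : ℕ) :
    PMF (Setoid V) :=
  (leaderCompression σ k (thresholdGraph (α ^ k) (mpxHierarchy δ (k + 1))) (mpxHierarchy δ k) r).map
    (joinIncomplete (thresholdGraph (α ^ k) (mpxHierarchy δ (k + 1))) (mpxHierarchy δ (k + 1)))

/-- The final hierarchy `H` up to level `α ^ (m - 1)`, given the delays: `H 0` is the partition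
into singletons and `H (k + 1)` is the partition of level `α ^ k`; the levels use independent
coins. -/
def finalHierarchy (σ : Choices V) (α : ℝ) (r : ℕ) {K : ℕ} (δ : Fin (K + 1) × V → ℝ) :
    ℕ → PMF (ℕ → Setoid V)
  | 0 => PMF.pure fun _ => ⊥
  | m + 1 => (finalHierarchy σ α r δ m).bind fun H =>
      (levelPartition σ α r δ m).map fun P => Function.update H (m + 1) P

/-- The law of the output of the algorithm, given the delays, with levels `1, α, …, α ^ K`,
`r₁` rounds of leader compression and `r₂` rounds of the modified Borůvka algorithm. -/
def outputLaw (σ : Choices V) (α : ℝ) (r₁ r₂ : ℕ) {K : ℕ} (δ : Fin (K + 1) × V → ℝ) :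
    PMF (Finset (Sym2 V)) :=
  (finalHierarchy σ α r₁ δ (K + 1)).bind fun H => buildTree σ α r₂ H (K + 1)

/-- The law of the delays: they are independent, and those of level `t = α ^ k` are exponential
with rate `c log n / t`, where `n` is the number of vertices. -/
def delayMeasure (V : Type*) [Fintype V] (α c : ℝ) (K : ℕ) :
    MeasureTheory.Measure (Fin (K + 1) × V → ℝ) :=
  MeasureTheory.Measure.pi fun p =>
    ProbabilityTheory.expMeasure (c * Real.log (Fintype.card V) / α ^ (p.1 : ℕ))

/-- The expected weight of the output, given the delays. -/
def meanWeight (σ : Choices V) (α : ℝ) (r₁ r₂ : ℕ) {K : ℕ} (δ : Fin (K + 1) × V → ℝ) : ℝ :=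
  ∑ T : Finset (Sym2 V), (outputLaw σ α r₁ r₂ δ T).toReal * weight T

/-- The index of the top level: the least `K` with `W ≤ α ^ K` (for `1 < α` and `1 ≤ W`). -/
def topLevel (α W : ℝ) : ℕ := ⌈Real.logb α W⌉₊

end Algorithm

end MetricMST

end

set_option linter.unusedSectionVars false

/-! The weight of an edge set is the integral over `s` of the number of its edges longer than `s`
(`ofReal_weight_eq`), so the output is compared with a spanning tree `S` by counting long edges at
every threshold.

At one level, the shortest-edge rule makes the number of Borůvka edges longer than `s` at most the
number of components that remain to be merged once all edges of length at most `s` are contracted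
(`boruvka_count`). The star edges are bounded by the diameter, and their mean number carries a
factor `(3/4) ^ r₂`, since a component with an outgoing edge disappears with probability at least
1/4 in each round.

The levels are added in `sum_restrictedClasses_le`. For `s` in `[α ^ j, α ^ (j + 1))` the levels
below `j` have no edge longer than `s`; level `j` contributes at most the excess pieces of its sets;
level `j + 1` is charged to the edges of `S` that are longer than `s` or cut by the MPX partition
two levels above `j`; the higher levels telescope. Hence the cost is `w(S)` plus, for each `j`, `α ^
(j + 1)` times an excess, a cut count and the star term.

The excess is at most the number of incomplete components, which leader compression shrinks by 3/4
per round in the mean. The exponential distribution has no memory, so an edge of length `d` is cut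
at level `t` with probability at most `3 d c log n / t` (`measure_centers_ne_le`), and the cut count
at level `j + 2` has mean `O(log n) w(S) / α ^ (j + 2)`. Over the `O(log n)` levels this sums to
`O(log² n / α) w(S)`, which is at most `ε w(S) / 4` by the choice of `A₀`; the terms with `r₁` and
`r₂` are small because the powers of 3/4 beat every fixed power of `log n / ε`.

These estimates need sets of bounded diameter, which fails only if some delay is too long. That has
polynomially small probability, and the output is then still a spanning tree, of weight at most `(n
- 1) W`. It is a spanning tree always, because each level connects its sets and adds no more edges
than sets disappear (`levelEdges_spec`). -/

namespace MetricMST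

/-! ### Counting the sets of a partition. -/

section Counting

variable {V : Type*}

/-- The number of sets of a partition. -/
noncomputable def numClasses (P : Setoid V) : ℕ := Nat.card (Quotient P)

lemma le_contract (P : Setoid V) (f : Quotient P → Quotient P) : P ≤ contract P f :=
  fun _ _ h => congrArg f (Quotient.sound h)

lemma contract_le {P S : Setoid V} {f : Quotient P → Quotient P} (hP : P ≤ S)
    (h : ∀ u, ∃ v, f (Quotient.mk P u) = Quotient.mk P v ∧ S u v) : contract P f ≤ S := by
  intro u v huv
  obtain ⟨u', hu, hu'⟩ := h u
  obtain ⟨v', hv, hv'⟩ := h v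
  have huv' : f (Quotient.mk P u) = f (Quotient.mk P v) := huv
  have : Quotient.mk P u' = Quotient.mk P v' := by rw [← hu, ← hv, huv']
  exact S.trans hu' (S.trans (hP (Quotient.exact this)) (S.symm hv'))

lemma conn_le {E : SimpleGraph V} {S : Setoid V} (h : ∀ u v, E.Adj u v → S u v) :
    E.reachableSetoid ≤ S := by
  rintro u v ⟨p⟩
  induction p with
  | nil => exact S.refl _
  | cons ha _ ih => exact S.trans (h _ _ ha) ih

lemma conn_of_adj {E : SimpleGraph V} {u v : V} (h : E.Adj u v) : E.reachableSetoid u v :=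
  h.reachable

lemma conn_mono {E F : SimpleGraph V} (h : E ≤ F) : E.reachableSetoid ≤ F.reachableSetoid :=
  conn_le fun _ _ huv => conn_of_adj (h huv)

lemma numClasses_bot : numClasses (⊥ : Setoid V) = Nat.card V :=
  (Nat.card_congr (Equiv.ofBijective (Quotient.mk (⊥ : Setoid V))
    ⟨fun _ _ h => Quotient.exact h, Quotient.mk_surjective⟩)).symm

variable [Finite V]

lemma numClasses_anti {P Q : Setoid V} (h : P ≤ Q) : numClasses Q ≤ numClasses P :=
  Nat.card_le_card_of_surjective (Quotient.map' id h) fun C => by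
    induction C using Quotient.inductionOn with
    | h v => exact ⟨Quotient.mk P v, rfl⟩

lemma numClasses_pos [Nonempty V] (P : Setoid V) : 0 < numClasses P := by
  have : Nonempty (Quotient P) := ⟨Quotient.mk P (Classical.arbitrary V)⟩
  exact Nat.card_pos

lemma numClasses_top [Nonempty V] : numClasses (⊤ : Setoid V) = 1 := by
  refine le_antisymm ?_ (numClasses_pos _)
  refine Finite.card_le_one_iff_subsingleton.2 ⟨fun C D => ?_⟩
  induction C using Quotient.inductionOn with
  | h u => induction D using Quotient.inductionOn with
    | h v => exact Quotient.sound trivial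

lemma rel_of_numClasses_le_one {P : Setoid V} (h : numClasses P ≤ 1) (u v : V) : P u v := by
  have := Finite.card_le_one_iff_subsingleton.1 h
  exact Quotient.exact (Subsingleton.elim (Quotient.mk P u) (Quotient.mk P v))

/-- If every set of `R` in `J` gets merged in `R'` with a set of `R` outside `J`, then `R'` has
`#J` sets less than `R`. -/
lemma numClasses_add_ncard_le {R R' : Setoid V} (h : R ≤ R') (J : Set (Quotient R))
    (hJ : ∀ u, Quotient.mk R u ∈ J → ∃ v, Quotient.mk R v ∉ J ∧ R' u v) :
    numClasses R' + J.ncard ≤ numClasses R := by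
  have h1 : numClasses R' ≤ (Jᶜ).ncard := by
    rw [numClasses, ← Set.ncard_univ]
    refine le_trans (Set.ncard_le_ncard (t := (Quotient.map' id h) '' Jᶜ) ?_)
      (Set.ncard_image_le)
    intro C _
    induction C using Quotient.inductionOn with
    | h u =>
      by_cases hu : Quotient.mk R u ∈ J
      · obtain ⟨v, hv, huv⟩ := hJ u hu
        exact ⟨Quotient.mk R v, hv, Quotient.sound (R'.symm huv)⟩
      · exact ⟨Quotient.mk R u, hu, rfl⟩
  have h2 := Set.ncard_add_ncard_compl J
  unfold numClasses at *
  omega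

-- One added pair can merge only two sets. The hypothesis describes the join by its universal
-- property, so that it applies to any partition generated by `P` and the pair, however it was
-- built.
open scoped Classical in
lemma numClasses_le_succ {P S : Setoid V} (u v : V)
    (h : ∀ T : Setoid V, P ≤ T → T u v → S ≤ T) : numClasses P ≤ numClasses S + 1 := by
  set f : Quotient P → Quotient P :=
    fun C => if C = Quotient.mk P u then Quotient.mk P v else C with hf
  have h1 : numClasses (contract P f) ≤ numClasses S := by
    refine numClasses_anti (h _ (le_contract P f) ?_)
    change f _ = f _
    simp [hf]
  refine le_trans ?_ (Nat.add_le_add_right h1 1)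
  rw [numClasses, numClasses, ← Finite.card_option]
  -- The contraction loses only the set of `u`, which is sent to `none`; the others stay distinct.
  refine Nat.card_le_card_of_injective (fun C : Quotient P =>
    if C = Quotient.mk P u then none else some (Quotient.mk (contract P f) C.out)) ?_
  intro C D hCD
  by_cases hC : C = Quotient.mk P u <;> by_cases hD : D = Quotient.mk P u
  · rw [hC, hD]
  · simp [hC, hD] at hCD
  · simp [hC, hD] at hCD
  · simp only [hC, hD, if_false, Option.some.injEq] at hCD
    have h2 : f (Quotient.mk P C.out) = f (Quotient.mk P D.out) := Quotient.exact hCD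
    simpa [hf, hC, hD] using h2

/-- Adding the edges `F` to `P` lowers the number of sets by at most `#F`. -/
lemma numClasses_le_add_card (F : Finset (Sym2 V)) (P : Setoid V) :
    ∀ S : Setoid V, (∀ T : Setoid V, P ≤ T → (∀ u v, s(u, v) ∈ F → T u v) → S ≤ T) →
      numClasses P ≤ numClasses S + F.card := by
  classical
  induction F using Finset.induction_on with
  | empty => exact fun S hS => le_trans (numClasses_anti (hS P le_rfl (by simp))) (by simp)
  | insert e F he ih =>
    intro S hS
    -- The partition generated by `P` and the edges of `F`.
    set S' : Setoid V := sInf {T | P ≤ T ∧ ∀ u v, s(u, v) ∈ F → T u v} with hS'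
    have h1 := ih S' (fun T h1 h2 => sInf_le ⟨h1, h2⟩)
    induction e using Sym2.inductionOn with
    | hf a b =>
      have h2 : numClasses S' ≤ numClasses S + 1 := by
        refine numClasses_le_succ a b fun T hT hab => hS T ?_ ?_
        · exact le_trans (le_sInf fun T h => h.1) hT
        · intro u v huv
          rcases Finset.mem_insert.1 huv with h | h
          · rcases Sym2.eq_iff.1 h with ⟨rfl, rfl⟩ | ⟨rfl, rfl⟩
            · exact hab
            · exact T.symm hab
          · exact hT (show S' u v from fun T hT => hT.2 u v h)
      rw [Finset.card_insert_of_notMem he]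
      omega

/-- If `P` and the edges `F` connect everything, then `P` has at most `#F + 1` sets. -/
lemma numClasses_le_card_add_one [Nonempty V] (F : Finset (Sym2 V)) (P : Setoid V)
    (h : ∀ T : Setoid V, P ≤ T → (∀ u v, s(u, v) ∈ F → T u v) → T = ⊤) :
    numClasses P ≤ F.card + 1 := by
  have := numClasses_le_add_card F P ⊤ fun T h1 h2 => (h T h1 h2).ge
  rw [numClasses_top] at this
  omega

end Counting

end MetricMST

namespace MetricMST

/-! ### Leader compression: structure and incomplete components. -/

section LeaderCompression

variable {V : Type*} [Fintype V] [MetricSpace V]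

open scoped Classical in
/-- The component that `C` belongs to after a round of leader compression. -/
noncomputable def leaderMap (σ : Choices V) (k j : ℕ) (E : SimpleGraph V) (P : Setoid V)
    (x : Quotient P → Bool) (C : Quotient P) : Quotient P :=
  if x C = false ∧ (leaders E P x C).Nonempty then σ.lead k j E P x C else C

variable {σ : Choices V} {k j : ℕ} {E : SimpleGraph V} {P : Setoid V} {x : Quotient P → Bool}

lemma leaderStep_eq : leaderStep σ k j E P x = contract P (leaderMap σ k j E P x) := rfl

lemma leaderMap_mem {C : Quotient P} (h : x C = false ∧ (leaders E P x C).Nonempty) :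
    leaderMap σ k j E P x C ∈ leaders E P x C := by
  rw [leaderMap, if_pos h]
  exact σ.lead_mem k j E P x C h.2

lemma leaderMap_of_true {C : Quotient P} (h : x C = true) : leaderMap σ k j E P x C = C := by
  rw [leaderMap, if_neg]
  simp [h]

/-- A component that moves arrives at one with coin 1, which does not move, so joins have depth one.
-/
lemma leaderMap_idem (C : Quotient P) :
    leaderMap σ k j E P x (leaderMap σ k j E P x C) = leaderMap σ k j E P x C := by
  by_cases h : x C = false ∧ (leaders E P x C).Nonempty
  · exact leaderMap_of_true (leaderMap_mem h).1
  · have : leaderMap σ k j E P x C = C := if_neg h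
    rw [this, this]

/-- Every join runs along an edge of `E` whose ends are together afterwards, so only such edges need
checking. This weaker hypothesis is what keeps components connected through their own edges. -/
lemma leaderStep_le {S : Setoid V} (hP : P ≤ S)
    (h : ∀ u v, E.Adj u v → leaderStep σ k j E P x u v → S u v) :
    leaderStep σ k j E P x ≤ S := by
  rw [leaderStep_eq]
  refine contract_le hP fun u => ?_
  by_cases hu : x (Quotient.mk P u) = false ∧ (leaders E P x (Quotient.mk P u)).Nonempty
  · obtain ⟨-, u', v', hu', hv', hadj⟩ := leaderMap_mem (σ := σ) (k := k) (j := j) hu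
    refine ⟨v', hv'.symm, S.trans (hP (Quotient.exact hu'.symm)) (h u' v' hadj ?_)⟩
    change leaderMap σ k j E P x _ = leaderMap σ k j E P x _
    rw [hu', hv', leaderMap_idem]
  · exact ⟨u, if_neg hu, S.refl u⟩

/-- The incomplete components. -/
def incompleteSet (E : SimpleGraph V) (Q : Setoid V) : Set (Quotient Q) :=
  {C | ∃ v, Quotient.mk Q v = C ∧ Incomplete E Q v}

lemma incomplete_congr {Q : Setoid V} {u v : V} (h : Q u v) (hu : Incomplete E Q u) :
    Incomplete E Q v := by
  obtain ⟨a, b, h1, h2, h3⟩ := hu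
  exact ⟨a, b, Q.trans (Q.symm h) h1, fun hb => h2 (Q.trans h hb), h3⟩

/-- Each new component is represented by the old component into which it was merged. If the new one
is incomplete, its representative was incomplete and did not move, so it is outside the set of
components that joined a leader; all of those were incomplete. -/
lemma ncard_incompleteSet_leaderStep :
    (incompleteSet E (leaderStep σ k j E P x)).ncard +
      {C | x C = false ∧ (leaders E P x C).Nonempty}.ncard ≤ (incompleteSet E P).ncard := by
  set f := leaderMap σ k j E P x with hf
  set J : Set (Quotient P) := {C | x C = false ∧ (leaders E P x C).Nonempty} with hJ
  have hJsub : J ⊆ incompleteSet E P := by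
    rintro C ⟨hC, D, hD, u, v, hu, hv, hadj⟩
    refine ⟨u, hu, u, v, P.refl u, fun h => ?_, hadj⟩
    have : C = D := by rw [← hu, ← hv]; exact Quotient.sound h
    rw [this, hD] at hC
    exact Bool.noConfusion hC
  rw [← Set.ncard_sdiff_add_ncard_of_subset hJsub]
  refine Nat.add_le_add_right ?_ _
  refine Set.ncard_le_ncard_of_injOn (s := incompleteSet E (contract P f))
    (Quotient.lift (fun v => f (Quotient.mk P v)) fun u v h => h) ?_ ?_
  · rintro _ ⟨v, rfl, u, w, hu, hw, hadj⟩
    change f _ ∈ _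
    have hu' : f (Quotient.mk P v) = f (Quotient.mk P u) := hu
    refine ⟨?_, ?_⟩
    · rw [hu']
      -- If the component of `u` moved, the edge it used leaves the leader; otherwise the outgoing
      -- edge at `u` already left the old component.
      by_cases h : x (Quotient.mk P u) = false ∧ (leaders E P x (Quotient.mk P u)).Nonempty
      · obtain ⟨h1, u', v', hu', hv', hadj⟩ := leaderMap_mem (σ := σ) (k := k) (j := j) h
        refine ⟨v', hv', v', u', P.refl _, fun h2 => ?_, hadj.symm⟩
        have h3 : leaderMap σ k j E P x (Quotient.mk P u) = Quotient.mk P u := by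
          exact hv'.symm.trans ((Quotient.sound h2).trans hu')
        rw [h3, h.1] at h1
        exact Bool.noConfusion h1
      · refine ⟨u, (if_neg h).symm, u, w, P.refl _, fun h2 => hw ?_, hadj⟩
        exact (contract P f).trans hu (le_contract P f h2)
    · intro h
      have h1 := leaderMap_mem (σ := σ) (k := k) (j := j) h
      rw [hf, leaderMap_idem, ← hf] at h1
      exact Bool.noConfusion (h.1.symm.trans h1.1)
  · intro C _ D _ h
    induction C using Quotient.inductionOn with
    | h u => induction D using Quotient.inductionOn with
      | h v => exact Quotient.sound h

lemma leaderCompression_induction {I : Setoid V → Prop} (h0 : I P)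
    (hs : ∀ j Q x, I Q → I (leaderStep σ k j E Q x)) :
    ∀ r, ∀ Q ∈ (leaderCompression σ k E P r).support, I Q := by
  intro r
  induction r with
  | zero =>
    intro Q hQ
    rw [leaderCompression, PMF.mem_support_pure_iff] at hQ
    exact hQ ▸ h0
  | succ r ih =>
    intro Q hQ
    rw [leaderCompression, PMF.mem_support_bind_iff] at hQ
    obtain ⟨Q', hQ', hQ⟩ := hQ
    rw [PMF.mem_support_map_iff] at hQ
    obtain ⟨x, -, rfl⟩ := hQ
    exact hs _ _ _ (ih _ hQ')

lemma le_leaderCompression {r : ℕ} {Q : Setoid V}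
    (hQ : Q ∈ (leaderCompression σ k E P r).support) : P ≤ Q :=
  leaderCompression_induction (I := fun Q => P ≤ Q) le_rfl
    (fun _ _ _ h => h.trans (le_contract _ _)) r Q hQ

lemma leaderCompression_le {r : ℕ} {Q S : Setoid V}
    (hQ : Q ∈ (leaderCompression σ k E P r).support) (hP : P ≤ S)
    (hE : ∀ u v, E.Adj u v → S u v) : Q ≤ S :=
  leaderCompression_induction (I := fun Q => Q ≤ S) hP
    (fun _ _ _ h => leaderStep_le h fun u v huv _ => hE u v huv) r Q hQ

/-- Components that are connected by their edges of length at most `t` stay so. -/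
lemma leaderCompression_le_conn {r : ℕ} {Q : Setoid V} {t : ℝ}
    (hQ : Q ∈ (leaderCompression σ k E P r).support)
    (hE : ∀ u v, E.Adj u v → dist u v ≤ t)
    (hP : P ≤ (thresholdGraph t P).reachableSetoid) :
    Q ≤ (thresholdGraph t Q).reachableSetoid := by
  refine leaderCompression_induction
    (I := fun Q => Q ≤ (thresholdGraph t Q).reachableSetoid) hP ?_ r Q hQ
  intro j Q x h
  refine leaderStep_le (h.trans (conn_mono ?_)) ?_
  · exact fun u v huv => ⟨huv.1, huv.2.1, le_contract _ _ huv.2.2⟩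
  · exact fun u v huv huv' => conn_of_adj ⟨huv.ne, hE u v huv, huv'⟩

lemma le_joinIncomplete (E : SimpleGraph V) (R Q : Setoid V) : Q ≤ joinIncomplete E R Q :=
  le_sup_left

lemma joinIncomplete_le {R Q : Setoid V} (h : Q ≤ R) : joinIncomplete E R Q ≤ R := by
  refine sup_le h (Setoid.eqvGen_le fun u v huv => huv.2.2)

lemma joinIncomplete_of_adj {R Q : Setoid V} {u v : V} (h : E.Adj u v) (hR : R u v) :
    joinIncomplete E R Q u v := by
  by_cases hQ : Q u v
  · exact le_joinIncomplete E R Q hQ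
  · refine (le_sup_right : Relation.EqvGen.setoid _ ≤ joinIncomplete E R Q)
      (Relation.EqvGen.rel _ _ ⟨⟨u, v, Q.refl u, hQ, h⟩, ⟨v, u, Q.refl v, fun h' => hQ (Q.symm h'),
        h.symm⟩, hR⟩)

lemma joinIncomplete_complete {R Q : Setoid V} {u v : V} (h : joinIncomplete E R Q u v)
    (hu : ¬ Incomplete E Q u) : Q u v := by
  -- Gluing all incomplete components together, regardless of `R`, is coarser than the join and
  -- still leaves complete components alone.
  let S : Setoid V :=
    { r := fun u v => Q u v ∨ (Incomplete E Q u ∧ Incomplete E Q v)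
      iseqv := ⟨fun u => Or.inl (Q.refl u), fun h => h.imp Q.symm And.symm, by
        rintro u v w (h1 | h1) (h2 | h2)
        · exact Or.inl (Q.trans h1 h2)
        · exact Or.inr ⟨incomplete_congr (Q.symm h1) h2.1, h2.2⟩
        · exact Or.inr ⟨h1.1, incomplete_congr h2 h1.2⟩
        · exact Or.inr ⟨h1.1, h2.2⟩⟩ }
  have : joinIncomplete E R Q ≤ S :=
    sup_le (fun _ _ h => Or.inl h) (Setoid.eqvGen_le fun _ _ h => Or.inr ⟨h.1, h.2.1⟩)
  exact (this h).resolve_right fun h => hu h.1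

lemma numClasses_le_joinIncomplete (E : SimpleGraph V) (R Q : Setoid V) :
    numClasses Q ≤ numClasses (joinIncomplete E R Q) + (incompleteSet E Q).ncard := by
  have h1 : ((incompleteSet E Q)ᶜ).ncard ≤ numClasses (joinIncomplete E R Q) := by
    rw [numClasses, ← Set.ncard_univ]
    refine Set.ncard_le_ncard_of_injOn
      (Quotient.map' id (le_joinIncomplete E R Q)) (fun _ _ => Set.mem_univ _) ?_
    intro C hC D _ h
    induction C using Quotient.inductionOn with
    | h u => induction D using Quotient.inductionOn with
      | h v =>
        exact Quotient.sound (joinIncomplete_complete (Quotient.exact h) fun h' => hC ⟨u, rfl, h'⟩)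
  have h2 := Set.ncard_add_ncard_compl (incompleteSet E Q)
  unfold numClasses at *
  omega

/-- A single component is never incomplete, and `m ≤ 2 (m - 1)` for `m ≥ 2`. The form `numClasses Q
- 1` is the one bounded by the number of tree edges cut by `Q`. -/
lemma ncard_incompleteSet_le [Nonempty V] (E : SimpleGraph V) (Q : Setoid V) :
    (incompleteSet E Q).ncard ≤ 2 * (numClasses Q - 1) := by
  have h1 : (incompleteSet E Q).ncard ≤ numClasses Q := by
    rw [numClasses, ← Set.ncard_univ]
    exact Set.ncard_le_ncard (Set.subset_univ _)
  rcases Nat.lt_or_ge 1 (numClasses Q) with h | h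
  · omega
  · have : incompleteSet E Q = ∅ := by
      rw [Set.eq_empty_iff_forall_notMem]
      rintro _ ⟨v, rfl, u, w, hu, hw, -⟩
      exact hw (rel_of_numClasses_le_one h _ _)
    simp [this]

end LeaderCompression

end MetricMST

namespace MetricMST

/-! ### The modified Borůvka rounds and the count of long edges. -/

section Boruvka

variable {V : Type*} [Fintype V] [MetricSpace V]

@[simp] lemma edgeWeight_mk (u v : V) : edgeWeight s(u, v) = dist u v := rfl

/-- The edges of `E` of length at most `t`. -/
def shortEdges (E : SimpleGraph V) (t : ℝ) : SimpleGraph V where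
  Adj u v := E.Adj u v ∧ dist u v ≤ t
  symm := ⟨fun u v h => ⟨h.1.symm, by rw [dist_comm]; exact h.2⟩⟩
  loopless := ⟨fun _ h => h.1.ne rfl⟩

variable {σ : Choices V} {E : SimpleGraph V} {Q : Setoid V} {x : Quotient Q → Bool}

lemma IsShortestOutgoing.unique {C : Quotient Q} {p q : V × V}
    (hp : IsShortestOutgoing σ E Q C p) (hq : IsShortestOutgoing σ E Q C q) :
    s(p.1, p.2) = s(q.1, q.2) := by
  apply σ.edgeId_injective
  rcases hp.2 q hq.1 with h | ⟨h, h'⟩ <;> rcases hq.2 p hp.1 with g | ⟨g, g'⟩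
  · exact absurd h g.not_gt
  · exact absurd g h.ne'
  · exact absurd h g.ne'
  · exact le_antisymm h' g'

lemma exists_isShortestOutgoing (σ : Choices V) {C : Quotient Q} (h : (outgoing E Q C).Nonempty) :
    ∃ p, IsShortestOutgoing σ E Q C p := by
  obtain ⟨p, hp, hmin⟩ := Set.exists_min_image (outgoing E Q C)
    (fun p => toLex (dist p.1 p.2, σ.edgeId s(p.1, p.2))) (Set.toFinite _) h
  refine ⟨p, hp, fun q hq => ?_⟩
  have := hmin q hq
  rw [Prod.Lex.le_iff] at this
  simpa using this

open scoped Classical in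
/-- The component that `C` belongs to after a round of the modified Borůvka algorithm. -/
noncomputable def boruvkaMap (σ : Choices V) (E : SimpleGraph V) (Q : Setoid V)
    (x : Quotient Q → Bool) (C : Quotient Q) : Quotient Q :=
  if h : ∃ p, JoinsVia σ E Q x C p then Quotient.mk Q h.choose.2 else C

lemma boruvkaStep_fst (F : Finset (Sym2 V)) :
    (boruvkaStep σ E Q F x).1 = contract Q (boruvkaMap σ E Q x) := rfl

lemma mem_boruvkaStep_snd {F : Finset (Sym2 V)} {e : Sym2 V} :
    e ∈ (boruvkaStep σ E Q F x).2 ↔ e ∈ F ∨ ∃ C p, JoinsVia σ E Q x C p ∧ e = s(p.1, p.2) := by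
  simp [boruvkaStep]

lemma boruvkaMap_of_true {C : Quotient Q} (h : x C = true) : boruvkaMap σ E Q x C = C := by
  rw [boruvkaMap, dif_neg]
  rintro ⟨p, hp⟩
  exact Bool.noConfusion (h.symm.trans hp.2.1)

lemma boruvkaMap_of_joins {C : Quotient Q} (h : ∃ p, JoinsVia σ E Q x C p) :
    ∃ p, JoinsVia σ E Q x C p ∧ boruvkaMap σ E Q x C = Quotient.mk Q p.2 :=
  ⟨h.choose, h.choose_spec, by rw [boruvkaMap, dif_pos h]⟩

lemma contract_boruvkaMap_le {S : Setoid V} (hQ : Q ≤ S)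
    (h : ∀ C p, JoinsVia σ E Q x C p → S p.1 p.2) : contract Q (boruvkaMap σ E Q x) ≤ S := by
  refine contract_le hQ fun u => ?_
  by_cases hu : ∃ p, JoinsVia σ E Q x (Quotient.mk Q u) p
  · obtain ⟨p, hp, hp'⟩ := boruvkaMap_of_joins hu
    exact ⟨p.2, hp', S.trans (hQ (Quotient.exact hp.1.1.2.1.symm)) (h _ _ hp)⟩
  · exact ⟨u, dif_neg hu, S.refl u⟩

/-- Components that join have coin 0 and their targets have coin 1, so no target joins anything
itself and each joining component disappears. -/
lemma numClasses_contract_boruvkaMap :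
    numClasses (contract Q (boruvkaMap σ E Q x)) + {C | ∃ p, JoinsVia σ E Q x C p}.ncard ≤
      numClasses Q := by
  refine numClasses_add_ncard_le (le_contract _ _) _ fun u hu => ?_
  obtain ⟨p, hp, hp'⟩ := boruvkaMap_of_joins hu
  refine ⟨p.2, fun ⟨q, hq⟩ => Bool.noConfusion (hp.2.2.symm.trans hq.2.1), ?_⟩
  change boruvkaMap σ E Q x _ = boruvkaMap σ E Q x _
  rw [hp', boruvkaMap_of_true hp.2.2]

/-- If the shortest edge leaving `C` is longer than `t`, then no shorter edge leaves `C`. -/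
lemma eq_of_rel_sup_shortEdges {C : Quotient Q} {p : V × V} {t : ℝ}
    (hp : IsShortestOutgoing σ E Q C p) (ht : t < dist p.1 p.2) {u v : V}
    (h : (Q ⊔ (shortEdges E t).reachableSetoid) u v) (hu : Quotient.mk Q u = C) :
    Quotient.mk Q v = C := by
  have key : ∀ u v, (shortEdges E t).Adj u v → Quotient.mk Q u = C → Quotient.mk Q v = C := by
    intro u v huv hu
    by_contra hv
    have := hp.2 (u, v) ⟨huv.1, hu, hv⟩
    have h2 := huv.2
    rcases this with h | ⟨h, -⟩ <;> simp only at h <;> linarith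
  have : Q ⊔ (shortEdges E t).reachableSetoid ≤ Setoid.ker fun v => Quotient.mk Q v = C := by
    refine sup_le (fun u v huv => ?_) (conn_le fun u v huv => ?_)
    · change (_ = C) = (_ = C)
      rw [Quotient.sound huv]
    · exact propext ⟨key u v huv, key v u huv.symm⟩
  have h' : (Quotient.mk Q u = C) = (Quotient.mk Q v = C) := this h
  exact h' ▸ hu

open scoped Classical in
/-- The number of new edges longer than `t` is at most the decrease of the number of components
with respect to the shorter edges. -/
lemma boruvkaStep_count (F : Finset (Sym2 V)) (t : ℝ) :
    ((boruvkaStep σ E Q F x).2.filter fun e => t < edgeWeight e).card +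
      numClasses (contract Q (boruvkaMap σ E Q x) ⊔ (shortEdges E t).reachableSetoid) ≤
    (F.filter fun e => t < edgeWeight e).card +
      numClasses (Q ⊔ (shortEdges E t).reachableSetoid) := by
  set R := Q ⊔ (shortEdges E t).reachableSetoid with hR
  set R' := contract Q (boruvkaMap σ E Q x) ⊔ (shortEdges E t).reachableSetoid with hR'
  have hQR : Q ≤ R := le_sup_left
  have hRR : R ≤ R' := sup_le_sup_right (le_contract _ _) _
  -- A component whose shortest outgoing edge is longer than `t` is by itself a whole set of `R`.
  -- Those that join now have coin 0 and are merged with a set containing a component of coin 1,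
  -- hence outside `J`.
  set J : Set (Quotient R) := {D | ∃ u p, D = Quotient.mk R u ∧
    JoinsVia σ E Q x (Quotient.mk Q u) p ∧ t < dist p.1 p.2} with hJ
  have h1 : numClasses R' + J.ncard ≤ numClasses R := by
    refine numClasses_add_ncard_le hRR J ?_
    rintro w ⟨u, q, hwu, hq, hqt⟩
    obtain ⟨p, hp, hp'⟩ := boruvkaMap_of_joins ⟨q, hq⟩
    refine ⟨p.2, ?_, ?_⟩
    · rintro ⟨v, q', hv, hq', hqt'⟩
      have h2 := eq_of_rel_sup_shortEdges hq'.1 hqt' (R.symm (Quotient.exact hv)) rfl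
      have h3 := hp.2.2
      rw [h2, hq'.2.1] at h3
      exact Bool.noConfusion h3
    · refine R'.trans (hRR (Quotient.exact hwu)) ((le_sup_left :
        contract Q (boruvkaMap σ E Q x) ≤ R') ?_)
      change boruvkaMap σ E Q x _ = boruvkaMap σ E Q x _
      rw [hp', boruvkaMap_of_true hp.2.2]
  set N : Finset (Sym2 V) := Finset.univ.filter fun e =>
    ∃ C p, JoinsVia σ E Q x C p ∧ e = s(p.1, p.2) ∧ t < dist p.1 p.2 with hN
  -- An edge is sent to the set of `R` at its joining end. That set is a single component of `Q`,
  -- whose shortest edge is unique by tie-breaking.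
  have h2 : N.card ≤ J.ncard := by
    rw [← Set.ncard_coe_finset]
    have hch : ∀ e : Sym2 V, ∃ p : V × V, e ∈ N →
        ∃ C, JoinsVia σ E Q x C p ∧ e = s(p.1, p.2) ∧ t < dist p.1 p.2 := by
      intro e
      by_cases he : e ∈ N
      · obtain ⟨C, p, h⟩ := (Finset.mem_filter.1 he).2
        exact ⟨p, fun _ => ⟨C, h⟩⟩
      · obtain ⟨a, b⟩ := e
        exact ⟨(a, b), fun h => absurd h he⟩
    choose g hg using hch
    refine Set.ncard_le_ncard_of_injOn (fun e => Quotient.mk R (g e).1) ?_ ?_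
    · intro e he
      obtain ⟨C, hp, -, ht⟩ := hg e he
      exact ⟨(g e).1, g e, rfl, by rw [hp.1.1.2.1]; exact hp, ht⟩
    · intro e he e' he' h
      obtain ⟨C, hp, h1, ht⟩ := hg e he
      obtain ⟨C', hp', h1', ht'⟩ := hg e' he'
      have h3 := eq_of_rel_sup_shortEdges hp.1 ht (Quotient.exact h) hp.1.1.2.1
      rw [hp'.1.1.2.1] at h3
      subst h3
      rw [h1, h1', hp.1.unique hp'.1]
  have h3 : ((boruvkaStep σ E Q F x).2.filter fun e => t < edgeWeight e) ⊆
      (F.filter fun e => t < edgeWeight e) ∪ N := by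
    intro e he
    rw [Finset.mem_filter, mem_boruvkaStep_snd] at he
    rw [Finset.mem_union, Finset.mem_filter]
    obtain ⟨he | ⟨C, p, hp, rfl⟩, ht⟩ := he
    · exact Or.inl ⟨he, ht⟩
    · exact Or.inr (Finset.mem_filter.2 ⟨Finset.mem_univ _, C, p, hp, rfl, ht⟩)
  have h4 := (Finset.card_le_card h3).trans (Finset.card_union_le _ _)
  omega

lemma boruvka_induction {P : Setoid V} {I : Setoid V × Finset (Sym2 V) → Prop} (h0 : I (P, ∅))
    (hs : ∀ s x, I s → I (boruvkaStep σ E s.1 s.2 x)) :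
    ∀ r, ∀ s ∈ (boruvka σ E P r).support, I s := by
  intro r
  induction r with
  | zero =>
    intro s hs'
    rw [boruvka, PMF.mem_support_pure_iff] at hs'
    exact hs' ▸ h0
  | succ r ih =>
    intro s hs'
    rw [boruvka, PMF.mem_support_bind_iff] at hs'
    obtain ⟨s', hs', h⟩ := hs'
    rw [PMF.mem_support_map_iff] at h
    obtain ⟨x, -, rfl⟩ := h
    exact hs _ _ (ih _ hs')

variable {P : Setoid V} {r : ℕ} {s : Setoid V × Finset (Sym2 V)}

lemma boruvka_fst_le {B : Setoid V} (hP : P ≤ B) (hE : ∀ u v, E.Adj u v → B u v)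
    (hs : s ∈ (boruvka σ E P r).support) : s.1 ≤ B :=
  boruvka_induction (I := fun s => s.1 ≤ B) hP
    (fun _ _ h => contract_boruvkaMap_le h fun _ _ hp => hE _ _ hp.1.1.1) r s hs

lemma boruvka_fst_le_of_edges {T : Setoid V} (hP : P ≤ T)
    (hs : s ∈ (boruvka σ E P r).support) (hT : ∀ u v, s(u, v) ∈ s.2 → T u v) : s.1 ≤ T := by
  refine boruvka_induction
    (I := fun s => (∀ u v, s(u, v) ∈ s.2 → T u v) → s.1 ≤ T) (fun _ => hP) ?_ r s hs hT
  intro s x h hT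
  refine contract_boruvkaMap_le (h fun u v huv => hT u v ?_) fun C p hp => hT _ _ ?_
  · exact mem_boruvkaStep_snd.2 (Or.inl huv)
  · exact mem_boruvkaStep_snd.2 (Or.inr ⟨C, p, hp, rfl⟩)

lemma boruvka_snd_subset (hs : s ∈ (boruvka σ E P r).support) : ∀ e ∈ s.2, e ∈ E.edgeSet := by
  refine boruvka_induction (I := fun s => ∀ e ∈ s.2, e ∈ E.edgeSet) (by simp) ?_ r s hs
  intro s x h e he
  rcases mem_boruvkaStep_snd.1 he with he | ⟨C, p, hp, rfl⟩
  · exact h e he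
  · exact hp.1.1.1

open scoped Classical in
lemma boruvka_count (hs : s ∈ (boruvka σ E P r).support) (t : ℝ) :
    (s.2.filter fun e => t < edgeWeight e).card +
      numClasses (s.1 ⊔ (shortEdges E t).reachableSetoid) ≤
    numClasses (P ⊔ (shortEdges E t).reachableSetoid) := by
  refine boruvka_induction (I := fun s => (s.2.filter fun e => t < edgeWeight e).card +
      numClasses (s.1 ⊔ (shortEdges E t).reachableSetoid) ≤
    numClasses (P ⊔ (shortEdges E t).reachableSetoid)) (by simp) ?_ r s hs
  exact fun s x h => (boruvkaStep_count s.2 t).trans h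

end Boruvka

/-! ### The connecting edges added at the end of a level. -/

section StarEdges

variable {V : Type*} [Fintype V] [MetricSpace V] {σ : Choices V} {k : ℕ} {B Q : Setoid V}

lemma root_rel (σ : Choices V) (k : ℕ) (B Q : Setoid V) (v : V) :
    B (σ.root k B Q (Quotient.mk B v)) v :=
  Quotient.exact (σ.root_mem k B Q (Quotient.mk B v))

lemma mem_starEdges_iff {e : Sym2 V} : e ∈ starEdges σ k B Q ↔ ∃ v,
    Quotient.mk Q (σ.root k B Q (Quotient.mk B v)) ≠ Quotient.mk Q v ∧
      e = s((σ.link k B Q (Quotient.mk Q (σ.root k B Q (Quotient.mk B v))) (Quotient.mk Q v)).1,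
        (σ.link k B Q (Quotient.mk Q (σ.root k B Q (Quotient.mk B v))) (Quotient.mk Q v)).2) := by
  simp [starEdges]

lemma mem_starEdges {e : Sym2 V} (he : e ∈ starEdges σ k B Q) (hQ : Q ≤ B) :
    ∃ a b, e = s(a, b) ∧ ¬ Q a b ∧ B a b := by
  obtain ⟨v, hv, rfl⟩ := mem_starEdges_iff.1 he
  obtain ⟨h1, h2⟩ := σ.link_mem k B Q
    (Quotient.mk Q (σ.root k B Q (Quotient.mk B v))) (Quotient.mk Q v)
  refine ⟨_, _, rfl, fun h => hv ?_, ?_⟩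
  · exact h1.symm.trans ((Quotient.sound h).trans h2)
  · exact B.trans (hQ (Quotient.exact h1))
      (B.trans (root_rel σ k B Q v) (B.symm (hQ (Quotient.exact h2))))

lemma le_of_starEdges {T : Setoid V} (hQ : Q ≤ T)
    (hT : ∀ u v, s(u, v) ∈ starEdges σ k B Q → T u v) : B ≤ T := by
  have key : ∀ v, T (σ.root k B Q (Quotient.mk B v)) v := by
    intro v
    by_cases hv : Quotient.mk Q (σ.root k B Q (Quotient.mk B v)) = Quotient.mk Q v
    · exact hQ (Quotient.exact hv)
    · obtain ⟨h1, h2⟩ := σ.link_mem k B Q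
        (Quotient.mk Q (σ.root k B Q (Quotient.mk B v))) (Quotient.mk Q v)
      exact T.trans (hQ (Quotient.exact h1.symm)) (T.trans
        (hT _ _ (mem_starEdges_iff.2 ⟨v, hv, rfl⟩)) (hQ (Quotient.exact h2)))
  intro u v huv
  have h := key u
  rw [show Quotient.mk B u = Quotient.mk B v from Quotient.sound huv] at h
  exact T.trans (T.symm h) (key v)

lemma card_starEdges_add_le (hQ : Q ≤ B) :
    (starEdges σ k B Q).card + numClasses B ≤ numClasses Q := by
  -- The components other than the chosen one in their set of `B`; each is merged with the chosen
  -- one.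
  set J : Set (Quotient Q) := {D | ∃ v, D = Quotient.mk Q v ∧
    Quotient.mk Q (σ.root k B Q (Quotient.mk B v)) ≠ Quotient.mk Q v} with hJ
  have h1 : numClasses B + J.ncard ≤ numClasses Q := by
    refine numClasses_add_ncard_le hQ J fun u _ => ?_
    refine ⟨σ.root k B Q (Quotient.mk B u), ?_, B.symm (root_rel σ k B Q u)⟩
    rintro ⟨v, hv, hne⟩
    have h2 : B u v := B.trans (B.symm (root_rel σ k B Q u)) (hQ (Quotient.exact hv))
    rw [← Quotient.sound h2] at hne
    exact hne hv
  have h2 : (starEdges σ k B Q).card ≤ J.ncard := by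
    rw [← Set.ncard_coe_finset]
    set f : Quotient Q → Sym2 V := fun D =>
      s((σ.link k B Q (Quotient.mk Q (σ.root k B Q (Quotient.mk B D.out))) D).1,
        (σ.link k B Q (Quotient.mk Q (σ.root k B Q (Quotient.mk B D.out))) D).2)
    refine (Set.ncard_le_ncard (t := f '' J) ?_).trans Set.ncard_image_le
    intro e he
    obtain ⟨v, hv, rfl⟩ := mem_starEdges_iff.1 (Finset.mem_coe.1 he)
    refine ⟨Quotient.mk Q v, ⟨v, rfl, hv⟩, ?_⟩
    have h3 : Quotient.mk B (Quotient.mk Q v).out = Quotient.mk B v :=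
      Quotient.sound (hQ (Quotient.mk_out v))
    simp only [f, h3]
  omega

end StarEdges

end MetricMST

namespace MetricMST

open scoped ENNReal

/-! ### Means under discrete laws. -/

section Expect

variable {α β : Type*}

/-- The mean of a nonnegative function under a discrete law. -/
noncomputable def expect (p : PMF α) (f : α → ℝ≥0∞) : ℝ≥0∞ := ∑' a, p a * f a

lemma expect_pure (a : α) (f : α → ℝ≥0∞) : expect (PMF.pure a) f = f a := by
  classical
  rw [expect, tsum_eq_single a]
  · simp
  · intro b hb
    simp [PMF.pure_apply, hb]

lemma expect_bind (p : PMF α) (q : α → PMF β) (f : β → ℝ≥0∞) :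
    expect (p.bind q) f = expect p fun a => expect (q a) f := by
  simp only [expect, PMF.bind_apply, ← ENNReal.tsum_mul_right, ← ENNReal.tsum_mul_left]
  rw [ENNReal.tsum_comm]
  simp only [mul_assoc]

lemma expect_map (p : PMF α) (g : α → β) (f : β → ℝ≥0∞) :
    expect (p.map g) f = expect p fun a => f (g a) := by
  rw [PMF.map, expect_bind]
  simp only [Function.comp, expect_pure]

lemma expect_mono {p : PMF α} {f g : α → ℝ≥0∞} (h : ∀ a ∈ p.support, f a ≤ g a) :
    expect p f ≤ expect p g := by
  refine ENNReal.tsum_le_tsum fun a => ?_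
  by_cases ha : a ∈ p.support
  · gcongr
    exact h a ha
  · rw [PMF.mem_support_iff, not_not] at ha
    simp [ha]

lemma expect_const (p : PMF α) (c : ℝ≥0∞) : expect p (fun _ => c) = c := by
  rw [expect, ENNReal.tsum_mul_right, p.tsum_coe, one_mul]

lemma expect_add (p : PMF α) (f g : α → ℝ≥0∞) :
    expect p (fun a => f a + g a) = expect p f + expect p g := by
  simp only [expect, mul_add, ENNReal.tsum_add]

lemma expect_const_mul (p : PMF α) (c : ℝ≥0∞) (f : α → ℝ≥0∞) :
    expect p (fun a => c * f a) = c * expect p f := by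
  simp only [expect, ← ENNReal.tsum_mul_left]
  exact tsum_congr fun a => by ring

lemma expect_sum {ι : Type*} (s : Finset ι) (p : PMF α) (f : ι → α → ℝ≥0∞) :
    expect p (fun a => ∑ i ∈ s, f i a) = ∑ i ∈ s, expect p (f i) := by
  classical
  induction s using Finset.induction_on with
  | empty => simpa using expect_const p 0
  | insert i s hi ih => simp only [Finset.sum_insert hi, expect_add, ih]

lemma expect_le_of_le {p : PMF α} {f : α → ℝ≥0∞} {c : ℝ≥0∞} (h : ∀ a ∈ p.support, f a ≤ c) :
    expect p f ≤ c :=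
  (expect_mono h).trans (expect_const p c).le

end Expect

/-! ### Fair coins: two distinct components show 0 and 1 with probability at least 1/4. -/

section Coins

variable {V : Type*} [Fintype V] {Q : Setoid V}

-- Forcing the two coins to 0 and 1 maps onto the favourable outcomes at most four to one, since an
-- outcome is recovered from its image and its two original coins.
open scoped Classical in
lemma one_le_four_mul_card_coins {C D : Quotient Q} (h : D ≠ C) :
    Fintype.card (Quotient Q → Bool) ≤
      4 * (Finset.univ.filter fun x : Quotient Q → Bool => x C = false ∧ x D = true).card := by
  let f : (Quotient Q → Bool) → Quotient Q → Bool := fun x =>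
    Function.update (Function.update x C false) D true
  refine (Finset.card_le_mul_card_image (f := f) Finset.univ 4 ?_).trans
    (Nat.mul_le_mul_left 4 (Finset.card_le_card ?_))
  · intro y _
    refine (Finset.card_le_card_of_injOn (t := (Finset.univ : Finset (Bool × Bool)))
      (fun x => (x C, x D)) (fun _ _ => Finset.mem_univ _) ?_).trans (by simp)
    intro x hx x' hx' hxx'
    have hf : f x = f x' := by
      rw [(Finset.mem_filter.1 (Finset.mem_coe.1 hx)).2,
        (Finset.mem_filter.1 (Finset.mem_coe.1 hx')).2]
    simp only [Prod.mk.injEq] at hxx'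
    funext A
    by_cases hD : A = D
    · rw [hD, hxx'.2]
    by_cases hC : A = C
    · rw [hC, hxx'.1]
    · simpa [f, hC, hD] using congrFun hf A
  · intro y hy
    obtain ⟨x, -, rfl⟩ := Finset.mem_image.1 hy
    simp [f, h.symm]

lemma expect_coins (f : (Quotient Q → Bool) → ℝ≥0∞) :
    ∃ _ : Fintype (Quotient Q → Bool),
      expect (coins Q) f = (Fintype.card (Quotient Q → Bool) : ℝ≥0∞)⁻¹ * ∑ x, f x := by
  classical
  refine ⟨inferInstance, ?_⟩
  rw [expect, tsum_fintype, Finset.mul_sum]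
  refine Finset.sum_congr rfl fun x _ => ?_
  simp only [coins, PMF.uniformOfFintype_apply]

open scoped Classical in
lemma quarter_le_expect_coins {C D : Quotient Q} (h : D ≠ C) :
    (1 / 4 : ℝ≥0∞) ≤ expect (coins Q) fun x => if x C = false ∧ x D = true then 1 else 0 := by
  have h1 := one_le_four_mul_card_coins h
  obtain ⟨inst, h2⟩ := expect_coins (Q := Q) fun x => if x C = false ∧ x D = true then 1 else 0
  rw [h2, Finset.sum_boole]
  have h0 : Fintype.card (Quotient Q → Bool) ≠ 0 := Fintype.card_ne_zero
  have h3 : (Fintype.card (Quotient Q → Bool) : ℝ≥0∞) ≤ 4 *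
      ((Finset.univ.filter fun x : Quotient Q → Bool => x C = false ∧ x D = true).card : ℝ≥0∞) := by
    have h4 : (Fintype.card (Quotient Q → Bool) : ℝ≥0∞) ≤ ((4 * (Finset.univ.filter
        fun x : Quotient Q → Bool => x C = false ∧ x D = true).card : ℕ) : ℝ≥0∞) :=
      Nat.cast_le.2 (by convert h1)
    push_cast at h4
    exact h4
  rw [mul_comm, ← div_eq_mul_inv, ENNReal.div_le_iff (by norm_num) (by norm_num)]
  rw [mul_comm, ← mul_div_assoc, ENNReal.le_div_iff_mul_le (Or.inl (by exact_mod_cast h0))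
    (Or.inl (by simp))]
  rw [one_mul]
  convert h3 using 1

open scoped Classical in
/-- If at least `N` components each have a partner, and every component with coin `0` whose
partner has coin `1` disappears, then the mean number of the remaining ones is at most `3 N / 4`. -/
lemma expect_coins_le (A : Finset (Quotient Q)) (g : Quotient Q → Quotient Q)
    (hg : ∀ C ∈ A, g C ≠ C) (φ : (Quotient Q → Bool) → ℕ) (N : ℕ) (hN : N ≤ A.card)
    (h : ∀ x, φ x + (A.filter fun C => x C = false ∧ x (g C) = true).card ≤ N) :
    expect (coins Q) (fun x => (φ x : ℝ≥0∞)) ≤ 3 / 4 * N := by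
  have h1 : expect (coins Q) (fun x => (φ x : ℝ≥0∞)) + 1 / 4 * N ≤ N := by
    calc _ ≤ expect (coins Q) (fun x => (φ x : ℝ≥0∞)) + ∑ C ∈ A, (1 / 4 : ℝ≥0∞) := by
          gcongr
          rw [Finset.sum_const, nsmul_eq_mul, mul_comm]
          gcongr
      _ ≤ expect (coins Q) (fun x => (φ x : ℝ≥0∞)) + ∑ C ∈ A, expect (coins Q)
            (fun x => if x C = false ∧ x (g C) = true then 1 else 0) := by
          gcongr with C hC
          exact quarter_le_expect_coins (hg C hC)
      _ = expect (coins Q) (fun x => ((φ x + (A.filter fun C =>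
            x C = false ∧ x (g C) = true).card : ℕ) : ℝ≥0∞)) := by
          rw [← expect_sum, ← expect_add]
          congr 1
          funext x
          rw [Finset.sum_boole]
          push_cast
          rfl
      _ ≤ N := expect_le_of_le fun x _ => by exact_mod_cast h x
  have h2 : (N : ℝ≥0∞) = 3 / 4 * N + 1 / 4 * N := by
    rw [← add_mul, ENNReal.div_add_div_same]
    norm_num
    rw [ENNReal.div_self (by norm_num) (by norm_num), one_mul]
  have h3 : expect (coins Q) (fun x => (φ x : ℝ≥0∞)) + 1 / 4 * N ≤ 3 / 4 * N + 1 / 4 * N :=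
    h1.trans h2.le
  exact (ENNReal.add_le_add_iff_right
    (ENNReal.mul_ne_top (by norm_num) (ENNReal.natCast_ne_top N))).1 h3

end Coins

/-! ### Geometric decay in both procedures. -/

section Decay

variable {V : Type*} [Fintype V] [MetricSpace V] {σ : Choices V} {E : SimpleGraph V}

lemma expect_leaderStep_le (k j : ℕ) (P : Setoid V) :
    expect (coins P) (fun x => ((incompleteSet E (leaderStep σ k j E P x)).ncard : ℝ≥0∞)) ≤
      3 / 4 * (incompleteSet E P).ncard := by
  classical
  have hch : ∀ C : Quotient P, ∃ D, C ∈ incompleteSet E P → D ≠ C ∧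
      ∃ u v, Quotient.mk P u = C ∧ Quotient.mk P v = D ∧ E.Adj u v := by
    intro C
    by_cases hC : C ∈ incompleteSet E P
    · obtain ⟨v, rfl, u, w, h1, h2, h3⟩ := hC
      exact ⟨Quotient.mk P w, fun _ => ⟨fun h => h2 (P.symm (Quotient.exact h)), u, w,
        Quotient.sound (P.symm h1), rfl, h3⟩⟩
    · exact ⟨C, fun h => absurd h hC⟩
  choose g hg using hch
  have hcard : (incompleteSet E P).toFinset.card = (incompleteSet E P).ncard :=
    (Set.ncard_eq_toFinset_card' _).symm
  refine expect_coins_le (incompleteSet E P).toFinset g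
    (fun C hC => (hg C (Set.mem_toFinset.1 hC)).1) _ _ hcard.ge fun x => ?_
  refine le_trans (Nat.add_le_add_left ?_ _) ncard_incompleteSet_leaderStep
  rw [← Set.ncard_coe_finset]
  refine Set.ncard_le_ncard fun C hC => ?_
  obtain ⟨hC, h1, h2⟩ := Finset.mem_filter.1 (Finset.mem_coe.1 hC)
  exact ⟨h1, g C, h2, (hg C (Set.mem_toFinset.1 hC)).2⟩

/-- The number of incomplete components decays exponentially. -/
lemma expect_leaderCompression_le (k : ℕ) (P : Setoid V) (r : ℕ) :
    expect (leaderCompression σ k E P r) (fun Q => ((incompleteSet E Q).ncard : ℝ≥0∞)) ≤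
      (3 / 4) ^ r * (incompleteSet E P).ncard := by
  induction r with
  | zero => simp [leaderCompression, expect_pure]
  | succ r ih =>
    rw [leaderCompression, expect_bind]
    simp only [expect_map]
    refine (expect_mono fun Q _ => expect_leaderStep_le k r Q).trans ?_
    rw [expect_const_mul, pow_succ', mul_assoc]
    gcongr

lemma expect_boruvkaStep_le {B Q : Setoid V} (hQ : Q ≤ B)
    (hE : ∀ u v, E.Adj u v ↔ u ≠ v ∧ B u v) (F : Finset (Sym2 V)) :
    expect (coins Q) (fun x =>
      ((numClasses (boruvkaStep σ E Q F x).1 - numClasses B : ℕ) : ℝ≥0∞)) ≤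
      3 / 4 * (numClasses Q - numClasses B : ℕ) := by
  classical
  set A : Set (Quotient Q) := {C | (outgoing E Q C).Nonempty} with hA
  have hch : ∀ C : Quotient Q, ∃ D, C ∈ A → D ≠ C ∧
      ∃ p, IsShortestOutgoing σ E Q C p ∧ Quotient.mk Q p.2 = D := by
    intro C
    by_cases hC : C ∈ A
    · obtain ⟨p, hp⟩ := exists_isShortestOutgoing σ hC
      exact ⟨Quotient.mk Q p.2, fun _ => ⟨hp.1.2.2, p, hp, rfl⟩⟩
    · exact ⟨C, fun h => absurd h hC⟩
  choose g hg using hch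
  -- `E` is complete inside the sets of `B`, so a component without outgoing edge is a whole set of
  -- `B`; there are at most `numClasses B` of these.
  have hcard : numClasses Q - numClasses B ≤ A.ncard := by
    have h1 : (Aᶜ).ncard ≤ numClasses B := by
      rw [numClasses, ← Set.ncard_univ]
      refine Set.ncard_le_ncard_of_injOn (Quotient.map' id hQ) (fun _ _ => Set.mem_univ _) ?_
      intro C hC D _ h
      induction C using Quotient.inductionOn with
      | h u => induction D using Quotient.inductionOn with
        | h v =>
          by_contra hne
          have huv : B u v := Quotient.exact h
          refine hC ⟨(u, v), (hE u v).2 ⟨fun h => hne (h ▸ rfl), huv⟩, rfl, Ne.symm hne⟩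
    have h2 := Set.ncard_add_ncard_compl A
    unfold numClasses at *
    omega
  rw [Set.ncard_eq_toFinset_card'] at hcard
  refine expect_coins_le A.toFinset g (fun C hC => (hg C (Set.mem_toFinset.1 hC)).1) _ _ hcard
    fun x => ?_
  have h1 : (A.toFinset.filter fun C => x C = false ∧ x (g C) = true).card ≤
      {C | ∃ p, JoinsVia σ E Q x C p}.ncard := by
    rw [← Set.ncard_coe_finset]
    refine Set.ncard_le_ncard fun C hC => ?_
    obtain ⟨hC, h1, h2⟩ := Finset.mem_filter.1 (Finset.mem_coe.1 hC)
    obtain ⟨-, p, hp, hp'⟩ := hg C (Set.mem_toFinset.1 hC)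
    exact ⟨p, hp, h1, hp' ▸ h2⟩
  have h2 := numClasses_contract_boruvkaMap (σ := σ) (E := E) (Q := Q) (x := x)
  have h3 : numClasses B ≤ numClasses (contract Q (boruvkaMap σ E Q x)) :=
    numClasses_anti (contract_boruvkaMap_le hQ fun C p hp => ((hE _ _).1 hp.1.1.1).2)
  rw [boruvkaStep_fst]
  omega

/-- The number of components that are still to be merged decays exponentially. -/
lemma expect_boruvka_le {B P : Setoid V} (hP : P ≤ B)
    (hE : ∀ u v, E.Adj u v ↔ u ≠ v ∧ B u v) (r : ℕ) :
    expect (boruvka σ E P r) (fun s => ((numClasses s.1 - numClasses B : ℕ) : ℝ≥0∞)) ≤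
      (3 / 4) ^ r * (numClasses P - numClasses B : ℕ) := by
  induction r with
  | zero => simp [boruvka, expect_pure]
  | succ r ih =>
    rw [boruvka, expect_bind]
    simp only [expect_map]
    refine (expect_mono fun s hs => expect_boruvkaStep_le
      (boruvka_fst_le hP (fun u v h => ((hE u v).1 h).2) hs) hE s.2).trans ?_
    rw [expect_const_mul, pow_succ', mul_assoc]
    gcongr

end Decay

end MetricMST

namespace MetricMST

open scoped ENNReal
open MeasureTheory

/-! ### Weights as integrals of edge counts. -/

section Weights

variable {V : Type*} [Fintype V] [MetricSpace V]

lemma edgeWeight_nonneg (e : Sym2 V) : 0 ≤ edgeWeight e := by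
  induction e using Sym2.inductionOn with
  | hf u v => exact dist_nonneg

lemma weight_nonneg (T : Finset (Sym2 V)) : 0 ≤ weight T :=
  Finset.sum_nonneg fun e _ => edgeWeight_nonneg e

lemma weight_union_le [DecidableEq (Sym2 V)] (T F : Finset (Sym2 V)) :
    weight (T ∪ F) ≤ weight T + weight F := by
  unfold weight
  rw [← Finset.sum_union_inter]
  exact le_add_of_nonneg_right (Finset.sum_nonneg fun e _ => edgeWeight_nonneg e)

lemma weight_le_card_mul {T : Finset (Sym2 V)} {L : ℝ} (h : ∀ e ∈ T, edgeWeight e ≤ L) :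
    weight T ≤ T.card * L := by
  have := Finset.sum_le_card_nsmul T _ L h
  rwa [nsmul_eq_mul] at this

lemma card_le_weight {T : Finset (Sym2 V)} (h : ∀ e ∈ T, 1 ≤ edgeWeight e) :
    (T.card : ℝ) ≤ weight T := by
  have := Finset.card_nsmul_le_sum T _ 1 h
  rwa [nsmul_eq_mul, mul_one] at this

lemma lintegral_ite_lt {w : ℝ} :
    ∫⁻ s in Set.Ici (0 : ℝ), (if s < w then (1 : ℝ≥0∞) else 0) = ENNReal.ofReal w := by
  have h : (fun s : ℝ => if s < w then (1 : ℝ≥0∞) else 0) = (Set.Iio w).indicator 1 := by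
    funext s
    simp [Set.indicator_apply]
  rw [h, lintegral_indicator_one measurableSet_Iio, Measure.restrict_apply measurableSet_Iio,
    Set.inter_comm, Set.Ici_inter_Iio, Real.volume_Ico, sub_zero]

open scoped Classical in
/-- The weight of a set of edges as an integral of the number of its edges longer than `s`. -/
lemma ofReal_weight_eq (F : Finset (Sym2 V)) :
    ENNReal.ofReal (weight F) =
      ∫⁻ s in Set.Ici (0 : ℝ), ((F.filter fun e => s < edgeWeight e).card : ℝ≥0∞) := by
  simp only [Finset.card_filter, Nat.cast_sum, Nat.cast_ite, Nat.cast_one, Nat.cast_zero]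
  rw [lintegral_finsetSum]
  · simp only [lintegral_ite_lt]
    rw [weight, ENNReal.ofReal_sum_of_nonneg fun e _ => edgeWeight_nonneg e]
  · intro e _
    exact Measurable.ite measurableSet_Iio measurable_const measurable_const

end Weights

/-! ### Cost of one level. -/

section Level

variable {V : Type*} [Fintype V] [MetricSpace V] {σ : Choices V}

/-- The number of components of `A` inside `B`, after contracting the edges of length at most
`s` inside the sets of `B`. -/
noncomputable def restrictedClasses (A B : Setoid V) (s : ℝ) : ℕ :=
  numClasses (A ⊔ (thresholdGraph s B).reachableSetoid)

lemma thresholdGraph_mono {s t : ℝ} (h : s ≤ t) {B C : Setoid V} (hB : B ≤ C) :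
    thresholdGraph s B ≤ thresholdGraph t C :=
  fun _ _ huv => ⟨huv.1, huv.2.1.trans h, hB huv.2.2⟩

lemma restrictedClasses_antitone (A B : Setoid V) : Antitone (restrictedClasses A B) :=
  fun _ _ h => numClasses_anti (sup_le_sup_left (conn_mono (thresholdGraph_mono h le_rfl)) _)

lemma conn_thresholdGraph_le (s : ℝ) (B : Setoid V) :
    (thresholdGraph s B).reachableSetoid ≤ B :=
  conn_le fun _ _ h => h.2.2

lemma numClasses_le_restrictedClasses {A B : Setoid V} (h : A ≤ B) (s : ℝ) :
    numClasses B ≤ restrictedClasses A B s :=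
  numClasses_anti (sup_le h (conn_thresholdGraph_le s B))

lemma restrictedClasses_le (A B : Setoid V) (s : ℝ) : restrictedClasses A B s ≤ numClasses A :=
  numClasses_anti le_sup_left

/-- A bound for the weight of the edges that connect the components of `A` inside `B`. -/
noncomputable def forestCost (A B : Setoid V) (L : ℝ) : ℝ≥0∞ :=
  ∫⁻ s in Set.Ici (0 : ℝ),
    if s < L then ((restrictedClasses A B s - numClasses B : ℕ) : ℝ≥0∞) else 0

lemma measurable_forestCost (A B : Setoid V) (L : ℝ) : Measurable fun s : ℝ =>
    if s < L then ((restrictedClasses A B s - numClasses B : ℕ) : ℝ≥0∞) else 0 := by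
  refine Measurable.ite measurableSet_Iio ?_ measurable_const
  have h : Antitone fun s => restrictedClasses A B s - numClasses B :=
    fun s t h => Nat.sub_le_sub_right (restrictedClasses_antitone A B h) _
  exact (measurable_from_nat (f := fun n : ℕ => (n : ℝ≥0∞))).comp h.measurable

lemma weight_boruvka_le {A B : Setoid V} {L : ℝ} (hA : A ≤ B)
    (hB : ∀ u v, B u v → dist u v ≤ L) {r : ℕ} {s : Setoid V × Finset (Sym2 V)}
    (hs : s ∈ (boruvka σ (thresholdGraph L B) A r).support) :
    ENNReal.ofReal (weight s.2) ≤ forestCost A B L := by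
  classical
  rw [ofReal_weight_eq, forestCost]
  refine lintegral_mono fun t => ?_
  have hle : ∀ u v, (thresholdGraph L B).Adj u v → B u v := fun u v h => h.2.2
  -- Since `L` bounds the diameter, the threshold `L` removes no edge inside a set of `B`.
  have hE : shortEdges (thresholdGraph L B) t = thresholdGraph t B := by
    ext u v
    exact ⟨fun h => ⟨h.1.1, h.2, h.1.2.2⟩, fun h => ⟨⟨h.1, hB _ _ h.2.2, h.2.2⟩, h.2.1⟩⟩
  have h1 := boruvka_count hs t
  rw [hE] at h1
  have h2 := numClasses_le_restrictedClasses (boruvka_fst_le hA hle hs) t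
  simp only []
  split_ifs with ht
  · rw [Nat.cast_le]
    unfold restrictedClasses at *
    omega
  · have : (s.2.filter fun e => t < edgeWeight e) = ∅ := by
      refine Finset.filter_eq_empty_iff.2 fun e he => ?_
      have he' := boruvka_snd_subset hs e he
      induction e using Sym2.inductionOn with
      | hf u v =>
        have h3 : dist u v ≤ L := he'.2.1
        rw [edgeWeight_mk]
        linarith
    simp [this]

lemma weight_starEdges_le {B Q : Setoid V} {L : ℝ} (hQ : Q ≤ B)
    (hB : ∀ u v, B u v → dist u v ≤ L) (k : ℕ) :
    ENNReal.ofReal (weight (starEdges σ k B Q)) ≤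
      ENNReal.ofReal L * (numClasses Q - numClasses B : ℕ) := by
  have h1 : weight (starEdges σ k B Q) ≤ (starEdges σ k B Q).card * L := by
    refine weight_le_card_mul fun e he => ?_
    obtain ⟨a, b, rfl, -, h⟩ := mem_starEdges he hQ
    exact hB _ _ h
  have h2 := card_starEdges_add_le (σ := σ) (k := k) hQ
  refine (ENNReal.ofReal_le_ofReal h1).trans ?_
  rw [ENNReal.ofReal_mul (Nat.cast_nonneg _), mul_comm, ENNReal.ofReal_natCast]
  gcongr
  omega

/-- The mean weight of the edges of one level. -/
lemma expect_levelEdges_le {A B : Setoid V} {α : ℝ} {k : ℕ} (hA : A ≤ B)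
    (hB : ∀ u v, B u v → dist u v ≤ α ^ (k + 1)) (r : ℕ) :
    expect (levelEdges σ α r k A B) (fun F => ENNReal.ofReal (weight F)) ≤
      forestCost A B (α ^ (k + 1)) + ENNReal.ofReal (α ^ (k + 1)) *
        ((3 / 4) ^ r * (numClasses A - numClasses B : ℕ)) := by
  classical
  rw [levelEdges, expect_map, ← pow_succ']
  have hE : ∀ u v, (thresholdGraph (α ^ (k + 1)) B).Adj u v ↔ u ≠ v ∧ B u v := fun u v =>
    ⟨fun h => ⟨h.1, h.2.2⟩, fun h => ⟨h.1, hB _ _ h.2, h.2⟩⟩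
  have hle := fun u v h => ((hE u v).1 h).2
  calc _ ≤ expect (boruvka σ (thresholdGraph (α ^ (k + 1)) B) A r) (fun s =>
        forestCost A B (α ^ (k + 1)) +
          ENNReal.ofReal (α ^ (k + 1)) * (numClasses s.1 - numClasses B : ℕ)) := by
        refine expect_mono fun s hs => ?_
        refine (ENNReal.ofReal_le_ofReal (weight_union_le _ _)).trans ?_
        rw [ENNReal.ofReal_add (weight_nonneg _) (weight_nonneg _)]
        exact add_le_add (weight_boruvka_le hA hB hs)
          (weight_starEdges_le (boruvka_fst_le hA hle hs) hB k)
    _ ≤ _ := by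
        rw [expect_add, expect_const, expect_const_mul]
        gcongr
        exact expect_boruvka_le hA hE r

lemma expect_buildTree_le {α : ℝ} (r : ℕ) (H : ℕ → Setoid V) (m : ℕ) :
    expect (buildTree σ α r H m) (fun T => ENNReal.ofReal (weight T)) ≤
      ∑ k ∈ Finset.range m,
        expect (levelEdges σ α r k (H k) (H (k + 1))) (fun F => ENNReal.ofReal (weight F)) := by
  classical
  induction m with
  | zero => simp [buildTree, expect_pure, weight]
  | succ m ih =>
    rw [buildTree, expect_bind, Finset.sum_range_succ]
    simp only [expect_map]
    refine le_trans (expect_mono fun T _ => expect_mono fun F _ =>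
      (ENNReal.ofReal_le_ofReal (weight_union_le T F)).trans
        ENNReal.ofReal_add_le) ?_
    simp only [expect_add, expect_const]
    gcongr

end Level

/-! ### Adding up the levels against a connecting edge set `S`. -/

section Hierarchy

variable {V : Type*} [Fintype V] [Nonempty V] [MetricSpace V]

open scoped Classical in
/-- The number of edges of `S` that cross the partition `R`. -/
noncomputable def cutCount (S : Finset (Sym2 V)) (R : Setoid V) : ℕ :=
  (S.filter fun e => ∃ u v, e = s(u, v) ∧ ¬ R u v).card

/-- The edges of `S` connect everything. -/
def Connects (S : Finset (Sym2 V)) : Prop :=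
  ∀ T : Setoid V, (∀ u v, s(u, v) ∈ S → T u v) → T = ⊤

lemma numClasses_le_cutCount {S : Finset (Sym2 V)} (hS : Connects S) (R : Setoid V) :
    numClasses R ≤ cutCount S R + 1 := by
  classical
  refine numClasses_le_card_add_one _ R fun T hT h => hS T fun u v huv => ?_
  by_cases hR : R u v
  · exact hT hR
  · exact h u v (Finset.mem_filter.2 ⟨huv, u, v, rfl, hR⟩)

-- The edges of `S` that are short and not cut by `R'` already lie in the threshold graph; adding
-- the remaining edges of `S` connects everything.
open scoped Classical in
lemma numClasses_thresholdGraph_le {S : Finset (Sym2 V)} (hS : Connects S) {R R' : Setoid V}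
    {s : ℝ} (h : ∀ u v, dist u v ≤ s → R' u v → R u v) :
    numClasses (thresholdGraph s R).reachableSetoid ≤
      (S.filter fun e => s < edgeWeight e).card + cutCount S R' + 1 := by
  have h1 := numClasses_le_card_add_one ((S.filter fun e => s < edgeWeight e) ∪
    (S.filter fun e => ∃ u v, e = s(u, v) ∧ ¬ R' u v)) (thresholdGraph s R).reachableSetoid ?_
  · have h2 := Finset.card_union_le (S.filter fun e => s < edgeWeight e)
      (S.filter fun e => ∃ u v, e = s(u, v) ∧ ¬ R' u v)
    unfold cutCount
    omega
  · intro T hT h3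
    refine hS T fun u v huv => ?_
    by_cases hR : R' u v
    · by_cases hs : dist u v ≤ s
      · by_cases hne : u = v
        · exact hne ▸ T.refl u
        · exact hT (conn_of_adj ⟨hne, hs, h u v hs hR⟩)
      · exact h3 u v (Finset.mem_union_left _ (Finset.mem_filter.2 ⟨huv, not_le.1 hs⟩))
    · exact h3 u v (Finset.mem_union_right _ (Finset.mem_filter.2 ⟨huv, u, v, rfl, hR⟩))

lemma sum_Ico_add_le {a N : ℕ → ℕ} {i m : ℕ} (him : i ≤ m)
    (h : ∀ k, i ≤ k → k < m → a k + N (k + 1) ≤ N k) :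
    ∑ k ∈ Finset.Ico i m, a k + N m ≤ N i := by
  induction m, him using Nat.le_induction with
  | base => simp
  | succ m him ih =>
    rw [Finset.sum_Ico_succ_top him]
    have h1 := ih fun k h1 h2 => h k h1 (h2.trans (Nat.lt_succ_self m))
    have h2 := h m him (Nat.lt_succ_self m)
    omega

/-- The number of connected pieces, with respect to edges of length at most `t`, that the sets of
`R` have in excess of one each. -/
noncomputable def excess (R : Setoid V) (t : ℝ) : ℕ :=
  numClasses (thresholdGraph t R).reachableSetoid - numClasses R

variable {S : Finset (Sym2 V)} {P H : ℕ → Setoid V} {K : ℕ} {α : ℝ}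

-- Here `P` stands for the nested MPX partitions and `H` for the final hierarchy, whose index is
-- shifted by one. For `s ≥ 1` only the `j` with `α ^ j ≤ s < α ^ (j + 1)` matters: smaller levels
-- vanish, levels `j` and `j + 1` are estimated separately, and the rest telescope.
open scoped Classical in
lemma sum_restrictedClasses_le (hS : Connects S) (hS1 : ∀ e ∈ S, 1 ≤ edgeWeight e) (hα : 1 < α)
    (h0 : H 0 = ⊥) (htop : H (K + 1) = ⊤) (hmono : ∀ k ≤ K, H k ≤ H (k + 1))
    (hcut : ∀ k ≤ K, ∀ u v, dist u v ≤ α ^ k → P (k + 1) u v → H (k + 1) u v) (s : ℝ) :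
    ∑ k ∈ Finset.range (K + 1), (if s < α ^ (k + 1) then
        restrictedClasses (H k) (H (k + 1)) s - numClasses (H (k + 1)) else 0) ≤
      (S.filter fun e => s < edgeWeight e).card +
        ∑ j ∈ Finset.range (K + 1), (if s ∈ Set.Ico (α ^ j) (α ^ (j + 1)) then
          excess (H (j + 1)) (α ^ j) + cutCount S (P (j + 2)) else 0) := by
  set a : ℕ → ℕ := fun k => if s < α ^ (k + 1) then
        restrictedClasses (H k) (H (k + 1)) s - numClasses (H (k + 1)) else 0 with ha
  have hle1 : ∀ k ≤ K, numClasses (H (k + 1)) ≤ restrictedClasses (H k) (H (k + 1)) s :=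
    fun k hk => numClasses_le_restrictedClasses (hmono k hk) s
  have hak : ∀ k ≤ K, a k + numClasses (H (k + 1)) ≤ numClasses (H k) := by
    intro k hk
    have h1 := hle1 k hk
    have h2 := restrictedClasses_le (H k) (H (k + 1)) s
    simp only [ha]
    split_ifs <;> omega
  have hN : numClasses (H (K + 1)) = 1 := by rw [htop, numClasses_top]
  have htel : ∀ i ≤ K + 1, ∑ k ∈ Finset.Ico i (K + 1), a k + 1 ≤ numClasses (H i) := by
    intro i hi
    have h := sum_Ico_add_le (a := a) (N := fun k => numClasses (H k)) hi
      fun k _ h => hak k (Nat.lt_succ_iff.1 h)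
    simpa only [hN] using h
  rcases lt_or_ge s 1 with hs | hs
  -- Below the minimum distance all edges of `S` count, and telescoping from singletons gives at
  -- most `n - 1`.
  · have h1 := htel 0 (Nat.zero_le _)
    rw [← Finset.range_eq_Ico, h0] at h1
    have h2 : (S.filter fun e => s < edgeWeight e) = S :=
      Finset.filter_true_of_mem fun e he => hs.trans_le (hS1 e he)
    have h3 : numClasses (⊥ : Setoid V) ≤ S.card + 1 :=
      numClasses_le_card_add_one S ⊥ fun T _ h => hS T h
    rw [h2]
    have h4 : ∑ k ∈ Finset.range (K + 1), a k ≤ S.card := by omega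
    exact h4.trans (Nat.le_add_right _ _)
  · obtain ⟨j, hj1, hj2⟩ := exists_nat_pow_near hs hα
    have hzero : ∀ k, k < j → a k = 0 := by
      intro k hk
      have : α ^ (k + 1) ≤ s := (pow_le_pow_right₀ hα.le hk).trans hj1
      simp only [ha, if_neg this.not_gt]
    rcases Nat.lt_or_ge K j with hKj | hjK
    · rw [Finset.sum_eq_zero fun k hk => hzero k ?_]
      · exact Nat.zero_le _
      · have := Finset.mem_range.1 hk
        omega
    · have hR : excess (H (j + 1)) (α ^ j) + cutCount S (P (j + 2)) ≤
          ∑ j ∈ Finset.range (K + 1), (if s ∈ Set.Ico (α ^ j) (α ^ (j + 1)) then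
            excess (H (j + 1)) (α ^ j) + cutCount S (P (j + 2)) else 0) := by
        refine le_trans (le_of_eq ?_) (Finset.single_le_sum (f := fun j =>
          if s ∈ Set.Ico (α ^ j) (α ^ (j + 1)) then
            excess (H (j + 1)) (α ^ j) + cutCount S (P (j + 2)) else 0)
            (fun _ _ => Nat.zero_le _) (Finset.mem_range.2 (Nat.lt_succ_iff.2 hjK)))
        simp only [if_pos (show s ∈ Set.Ico (α ^ j) (α ^ (j + 1)) from ⟨hj1, hj2⟩)]
      refine le_trans ?_ (Nat.add_le_add_left hR _)
      have hsum : ∑ k ∈ Finset.range (K + 1), a k =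
          a j + ∑ k ∈ Finset.Ico (j + 1) (K + 1), a k := by
        rw [Finset.range_eq_Ico, ← Finset.sum_Ico_consecutive a (Nat.zero_le j) (by omega),
          Finset.sum_eq_sum_Ico_succ_bot (by omega : j < K + 1)]
        rw [Finset.sum_eq_zero fun k hk => hzero k (Finset.mem_Ico.1 hk).2, zero_add]
      -- Since `α ^ j ≤ s`, contracting edges up to `s` leaves no more pieces than contracting those
      -- up to `α ^ j`.
      have haj : a j ≤ excess (H (j + 1)) (α ^ j) := by
        simp only [ha, if_pos hj2, excess]
        refine Nat.sub_le_sub_right (numClasses_anti ?_) _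
        exact le_trans (conn_mono (thresholdGraph_mono hj1 le_rfl)) le_sup_right
      rw [hsum]
      rcases Nat.eq_or_lt_of_le hjK with rfl | hjK
      · simp only [Finset.Ico_self, Finset.sum_empty]
        omega
      · rw [Finset.sum_eq_sum_Ico_succ_bot (by omega : j + 1 < K + 1)]
        have h1 := htel (j + 1 + 1) (by omega)
        -- Here `s < α ^ (j + 1)`, so an edge of `S` of length at most `s` not cut by `P (j + 2)`
        -- stays inside `H (j + 2)` by `hcut`. The `+ 1` cancels against the single set at the end
        -- of the telescope.
        have h2 : a (j + 1) + numClasses (H (j + 1 + 1)) ≤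
            (S.filter fun e => s < edgeWeight e).card + cutCount S (P (j + 2)) + 1 := by
          have h3 : s < α ^ (j + 1 + 1) :=
            hj2.trans_le (pow_le_pow_right₀ hα.le (Nat.le_succ _))
          simp only [ha, if_pos h3]
          rw [Nat.sub_add_cancel (hle1 (j + 1) hjK)]
          refine le_trans (numClasses_anti le_sup_right) (numClasses_thresholdGraph_le hS ?_)
          exact fun u v huv hP => hcut (j + 1) hjK u v (huv.trans hj2.le) hP
        omega

/-- The cost of the forests of all the levels, compared with a connected set of edges `S`. -/
lemma sum_forestCost_le (hS : Connects S) (hS1 : ∀ e ∈ S, 1 ≤ edgeWeight e) (hα : 1 < α)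
    (h0 : H 0 = ⊥) (htop : H (K + 1) = ⊤) (hmono : ∀ k ≤ K, H k ≤ H (k + 1))
    (hcut : ∀ k ≤ K, ∀ u v, dist u v ≤ α ^ k → P (k + 1) u v → H (k + 1) u v) :
    ∑ k ∈ Finset.range (K + 1), forestCost (H k) (H (k + 1)) (α ^ (k + 1)) ≤
      ENNReal.ofReal (weight S) + ∑ j ∈ Finset.range (K + 1), ENNReal.ofReal (α ^ (j + 1)) *
        ((excess (H (j + 1)) (α ^ j) : ℝ≥0∞) + cutCount S (P (j + 2))) := by
  classical
  simp only [forestCost]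
  rw [← lintegral_finsetSum _ fun k _ => measurable_forestCost _ _ _]
  calc _ ≤ ∫⁻ s in Set.Ici (0 : ℝ), (((S.filter fun e => s < edgeWeight e).card : ℝ≥0∞) +
        ∑ j ∈ Finset.range (K + 1), (Set.Ico (α ^ j) (α ^ (j + 1))).indicator (fun _ =>
          ((excess (H (j + 1)) (α ^ j) : ℝ≥0∞) + cutCount S (P (j + 2)))) s) := by
        refine lintegral_mono fun s => ?_
        have h := sum_restrictedClasses_le hS hS1 hα h0 htop hmono hcut s
        rw [← Nat.cast_le (α := ℝ≥0∞)] at h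
        push_cast at h
        simpa only [Set.indicator_apply, Nat.cast_ite, Nat.cast_add, Nat.cast_zero,
          ENNReal.natCast_sub] using h
    _ = ENNReal.ofReal (weight S) + ∑ j ∈ Finset.range (K + 1),
        ∫⁻ s in Set.Ici (0 : ℝ), (Set.Ico (α ^ j) (α ^ (j + 1))).indicator (fun _ =>
          ((excess (H (j + 1)) (α ^ j) : ℝ≥0∞) + cutCount S (P (j + 2)))) s := by
        rw [lintegral_add_right, ← ofReal_weight_eq, lintegral_finsetSum]
        · exact fun j _ => measurable_const.indicator measurableSet_Ico
        · exact Finset.measurable_sum _ fun j _ => measurable_const.indicator measurableSet_Ico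
    _ ≤ _ := by
        gcongr with j _
        rw [lintegral_indicator_const measurableSet_Ico, mul_comm]
        gcongr
        refine (Measure.restrict_apply_le _ _).trans ?_
        rw [Real.volume_Ico]
        exact ENNReal.ofReal_le_ofReal (sub_le_self _ (by positivity))

/-- The mean weight of the output, given the hierarchy. -/
lemma expect_buildTree_hierarchy_le {σ : Choices V} (hS : Connects S)
    (hS1 : ∀ e ∈ S, 1 ≤ edgeWeight e) (hα : 1 < α)
    (h0 : H 0 = ⊥) (htop : H (K + 1) = ⊤) (hmono : ∀ k ≤ K, H k ≤ H (k + 1))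
    (hcut : ∀ k ≤ K, ∀ u v, dist u v ≤ α ^ k → P (k + 1) u v → H (k + 1) u v)
    (hdiam : ∀ k ≤ K, ∀ u v, H (k + 1) u v → dist u v ≤ α ^ (k + 1)) (r : ℕ) :
    expect (buildTree σ α r H (K + 1)) (fun T => ENNReal.ofReal (weight T)) ≤
      ENNReal.ofReal (weight S) + ∑ j ∈ Finset.range (K + 1), ENNReal.ofReal (α ^ (j + 1)) *
        ((excess (H (j + 1)) (α ^ j) : ℝ≥0∞) + cutCount S (P (j + 2)) +
          (3 / 4) ^ r * (numClasses (H j) - 1 : ℕ)) := by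
  calc _ ≤ ∑ k ∈ Finset.range (K + 1), (forestCost (H k) (H (k + 1)) (α ^ (k + 1)) +
        ENNReal.ofReal (α ^ (k + 1)) * ((3 / 4) ^ r * (numClasses (H k) - 1 : ℕ))) := by
        refine (expect_buildTree_le r H (K + 1)).trans (Finset.sum_le_sum fun k hk => ?_)
        have hk' := Nat.lt_succ_iff.1 (Finset.mem_range.1 hk)
        refine (expect_levelEdges_le (hmono k hk') (hdiam k hk') r).trans ?_
        gcongr
        exact numClasses_pos _
    _ ≤ _ := by
        rw [Finset.sum_add_distrib]
        refine (add_le_add_left (sum_forestCost_le hS hS1 hα h0 htop hmono hcut) _).trans ?_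
        rw [add_assoc, ← Finset.sum_add_distrib]
        simp only [mul_add]
        exact le_rfl

end Hierarchy

end MetricMST

namespace MetricMST

open scoped ENNReal

/-! ### The output is a spanning tree for all delays and coins. -/

section SpanningTree

variable {V : Type*} [Fintype V] [MetricSpace V] {σ : Choices V}

lemma IsSpanningTree.connects {S : Finset (Sym2 V)} (h : IsSpanningTree S) : Connects S := by
  intro T hT
  refine eq_top_iff.2 fun u v _ => ?_
  have h1 : (SimpleGraph.fromEdgeSet (S : Set (Sym2 V))).reachableSetoid ≤ T :=
    conn_le fun a b hab => hT a b (SimpleGraph.fromEdgeSet_adj _ |>.1 hab).1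
  exact h1 (h.2.connected.preconnected u v)

lemma card_edgeSet_fromEdgeSet {S : Finset (Sym2 V)} (h : ∀ e ∈ S, ¬ e.IsDiag) :
    Nat.card (SimpleGraph.fromEdgeSet (S : Set (Sym2 V))).edgeSet = S.card := by
  rw [SimpleGraph.edgeSet_fromEdgeSet, sdiff_eq_left.2]
  · simp
  · exact Set.disjoint_left.2 fun e he hd => h e he hd

lemma IsSpanningTree.card_add_one {S : Finset (Sym2 V)} (h : IsSpanningTree S) :
    S.card + 1 = Fintype.card V := by
  have := (SimpleGraph.isTree_iff_connected_and_card.1 h.2).2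
  rwa [card_edgeSet_fromEdgeSet h.1, Nat.card_eq_fintype_card] at this

lemma isSpanningTree_of_connects [Nonempty V] {S : Finset (Sym2 V)} (h : ∀ e ∈ S, ¬ e.IsDiag)
    (hS : Connects S) (hcard : S.card + 1 ≤ Fintype.card V) : IsSpanningTree S := by
  refine ⟨h, SimpleGraph.isTree_iff_connected_and_card.2 ⟨?_, ?_⟩⟩
  · have h1 := hS (SimpleGraph.fromEdgeSet (S : Set (Sym2 V))).reachableSetoid fun u v huv =>
      conn_of_adj ((SimpleGraph.fromEdgeSet_adj _).2 ⟨huv, fun huv' => h _ huv huv'⟩)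
    refine (SimpleGraph.connected_iff _).2 ⟨fun u v => ?_, inferInstance⟩
    have h2 : (SimpleGraph.fromEdgeSet (S : Set (Sym2 V))).reachableSetoid u v := by
      rw [h1]; trivial
    exact h2
  · rw [card_edgeSet_fromEdgeSet h, Nat.card_eq_fintype_card]
    have h1 := numClasses_le_card_add_one S ⊥ fun T _ h => hS T h
    rw [numClasses_bot, Nat.card_eq_fintype_card] at h1
    omega

lemma IsSpanningTree.one_le_edgeWeight {S : Finset (Sym2 V)} (h : IsSpanningTree S)
    (hV : ∀ u v : V, u ≠ v → 1 ≤ dist u v) : ∀ e ∈ S, 1 ≤ edgeWeight e := by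
  intro e he
  induction e using Sym2.inductionOn with
  | hf u v => exact hV u v fun huv => h.1 _ he huv

lemma IsSpanningTree.weight_le [Nonempty V] {S : Finset (Sym2 V)} (h : IsSpanningTree S) {W : ℝ}
    (hV : ∀ u v : V, u ≠ v → dist u v ≤ W) : weight S ≤ ((Fintype.card V : ℝ) - 1) * W := by
  have h1 := weight_le_card_mul (T := S) (L := W) fun e he => by
    induction e using Sym2.inductionOn with
    | hf u v => exact hV u v fun huv => h.1 _ he huv
  have h2 : (S.card : ℝ) + 1 = Fintype.card V := by exact_mod_cast h.card_add_one
  rwa [← h2, add_sub_cancel_right]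

lemma levelEdges_spec {α : ℝ} {r k : ℕ} {A B : Setoid V} (hA : A ≤ B) {F : Finset (Sym2 V)}
    (hF : F ∈ (levelEdges σ α r k A B).support) :
    (∀ e ∈ F, ¬ e.IsDiag) ∧
    (∀ T : Setoid V, A ≤ T → (∀ u v, s(u, v) ∈ F → T u v) → B ≤ T) ∧
    F.card + numClasses B ≤ numClasses A := by
  classical
  rw [levelEdges, PMF.mem_support_map_iff] at hF
  obtain ⟨s, hs, rfl⟩ := hF
  have hsB : s.1 ≤ B := boruvka_fst_le (E := thresholdGraph (α * α ^ k) B) hA (fun u v h => h.2.2) hs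
  refine ⟨fun e he => ?_, fun T hT hF => ?_, ?_⟩
  · rcases Finset.mem_union.1 he with he | he
    · exact SimpleGraph.not_isDiag_of_mem_edgeSet _ (boruvka_snd_subset hs e he)
    · obtain ⟨a, b, rfl, h, -⟩ := mem_starEdges he hsB
      intro hd
      rw [Sym2.mk_isDiag_iff] at hd
      exact h (hd ▸ s.1.refl a)
  · refine le_of_starEdges (σ := σ) (k := k) (boruvka_fst_le_of_edges hT hs fun u v h =>
      hF u v (Finset.mem_union_left _ h)) fun u v h => hF u v (Finset.mem_union_right _ h)
  -- At a negative threshold every edge counts as long and nothing is contracted, so the count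
  -- bounds the number of all edges.
  · have h1 := boruvka_count hs (-1)
    have h2 : (s.2.filter fun e => (-1 : ℝ) < edgeWeight e) = s.2 :=
      Finset.filter_true_of_mem fun e _ => by linarith [edgeWeight_nonneg e]
    have h3 : (shortEdges (thresholdGraph (α * α ^ k) B) (-1)).reachableSetoid = ⊥ :=
      le_bot_iff.1 (conn_le fun u v h => by
        have h4 := h.2
        have h5 := dist_nonneg (x := u) (y := v)
        linarith)
    rw [h2, h3, sup_bot_eq, sup_bot_eq] at h1
    have h6 := card_starEdges_add_le (σ := σ) (k := k) hsB
    have h7 := Finset.card_union_le s.2 (starEdges σ k B s.1)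
    omega

lemma buildTree_spec {α : ℝ} {r : ℕ} {H : ℕ → Setoid V} (h0 : H 0 = ⊥) {m : ℕ}
    (hmono : ∀ k < m, H k ≤ H (k + 1)) {T : Finset (Sym2 V)}
    (hT : T ∈ (buildTree σ α r H m).support) :
    (∀ e ∈ T, ¬ e.IsDiag) ∧
    (∀ R : Setoid V, (∀ u v, s(u, v) ∈ T → R u v) → H m ≤ R) ∧
    T.card + numClasses (H m) ≤ Fintype.card V := by
  classical
  induction m generalizing T with
  | zero =>
    rw [buildTree, PMF.mem_support_pure_iff] at hT
    subst hT
    rw [h0, numClasses_bot, Nat.card_eq_fintype_card]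
    simp
  | succ m ih =>
    rw [buildTree, PMF.mem_support_bind_iff] at hT
    obtain ⟨T', hT', h⟩ := hT
    rw [PMF.mem_support_map_iff] at h
    obtain ⟨F, hF, rfl⟩ := h
    obtain ⟨h1, h2, h3⟩ := ih (fun k hk => hmono k (hk.trans (Nat.lt_succ_self m))) hT'
    obtain ⟨g1, g2, g3⟩ := levelEdges_spec (hmono m (Nat.lt_succ_self m)) hF
    refine ⟨fun e he => ?_, fun R hR => ?_, ?_⟩
    · exact (Finset.mem_union.1 he).elim (h1 e) (g1 e)
    · exact g2 R (h2 R fun u v huv => hR u v (Finset.mem_union_left _ huv))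
        fun u v huv => hR u v (Finset.mem_union_right _ huv)
    · have := Finset.card_union_le T' F
      omega

end SpanningTree

/-! ### The hierarchy and the mean weight for fixed delays. -/

section Output

variable {V : Type*} [Fintype V] [Nonempty V] [MetricSpace V] {σ : Choices V} {α : ℝ} {K : ℕ}
  {δ : Fin (K + 1) × V → ℝ}

lemma mpxHierarchy_mono (δ : Fin (K + 1) × V → ℝ) : Monotone (mpxHierarchy δ) :=
  fun _ _ h => iInf_mono fun _ => iInf_mono' fun hi => ⟨h.trans hi, le_rfl⟩

lemma mpxHierarchy_top (δ : Fin (K + 1) × V → ℝ) {k : ℕ} (hk : K < k) : mpxHierarchy δ k = ⊤ := by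
  refine eq_top_iff.2 (le_iInf fun i => le_iInf fun hi => ?_)
  have := i.2
  omega

lemma mpxHierarchy_le (δ : Fin (K + 1) × V → ℝ) (i : Fin (K + 1)) :
    mpxHierarchy δ i ≤ mpxDecomposition fun v => δ (i, v) :=
  iInf_le_of_le i (iInf_le_of_le le_rfl le_rfl)

lemma mem_finalHierarchy {r m : ℕ} {H : ℕ → Setoid V}
    (hH : H ∈ (finalHierarchy σ α r δ m).support) :
    H 0 = ⊥ ∧ ∀ j < m, H (j + 1) ∈ (levelPartition σ α r δ j).support := by
  induction m generalizing H with
  | zero =>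
    rw [finalHierarchy, PMF.mem_support_pure_iff] at hH
    subst hH
    simp
  | succ m ih =>
    rw [finalHierarchy, PMF.mem_support_bind_iff] at hH
    obtain ⟨H', hH', h⟩ := hH
    rw [PMF.mem_support_map_iff] at h
    obtain ⟨P, hP, rfl⟩ := h
    obtain ⟨h1, h2⟩ := ih hH'
    refine ⟨by simpa using h1, fun j hj => ?_⟩
    rcases Nat.lt_succ_iff_lt_or_eq.1 hj with hj | rfl
    · rw [Function.update_of_ne (by omega)]
      exact h2 j hj
    · simpa using hP

lemma expect_finalHierarchy (r : ℕ) {m j : ℕ} (hj : j < m) (f : Setoid V → ℝ≥0∞) :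
    expect (finalHierarchy σ α r δ m) (fun H => f (H (j + 1))) =
      expect (levelPartition σ α r δ j) f := by
  induction m with
  | zero => exact absurd hj (Nat.not_lt_zero j)
  | succ m ih =>
    rw [finalHierarchy, expect_bind]
    simp only [expect_map]
    rcases Nat.lt_succ_iff_lt_or_eq.1 hj with hj | rfl
    · rw [← ih hj]
      simp only [Function.update_of_ne (show j + 1 ≠ m + 1 by omega), expect_const]
    · simp only [Function.update_self, expect_const]

/-- The last property is what joining the incomplete components is for: afterwards no edge of the
level's graph leaves a set. -/
lemma levelPartition_spec {r k : ℕ} {R : Setoid V}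
    (hR : R ∈ (levelPartition σ α r δ k).support) :
    mpxHierarchy δ k ≤ R ∧ R ≤ mpxHierarchy δ (k + 1) ∧
      ∀ u v, dist u v ≤ α ^ k → mpxHierarchy δ (k + 1) u v → R u v := by
  rw [levelPartition, PMF.mem_support_map_iff] at hR
  obtain ⟨Q, hQ, rfl⟩ := hR
  refine ⟨(le_leaderCompression hQ).trans (le_joinIncomplete _ _ _),
    joinIncomplete_le (leaderCompression_le hQ (mpxHierarchy_mono δ (Nat.le_succ k))
      fun u v h => h.2.2), fun u v h h' => ?_⟩
  by_cases huv : u = v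
  · exact huv ▸ Setoid.refl' _ u
  · exact joinIncomplete_of_adj ⟨huv, h, h'⟩ h'

/-- The mean excess of the partition of a level. -/
lemma expect_excess_le {k : ℕ} (hdiam : ∀ u v, mpxHierarchy δ k u v → dist u v ≤ α ^ k) (r : ℕ) :
    expect (levelPartition σ α r δ k) (fun R => (excess R (α ^ k) : ℝ≥0∞)) ≤
      (3 / 4) ^ r * (2 * (numClasses (mpxHierarchy δ k) - 1) : ℕ) := by
  rw [levelPartition, expect_map]
  refine le_trans (expect_mono fun Q hQ => ?_) ((expect_leaderCompression_le (σ := σ)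
    (E := thresholdGraph (α ^ k) (mpxHierarchy δ (k + 1))) k (mpxHierarchy δ k) r).trans ?_)
  · rw [Nat.cast_le, excess]
    -- MPX sets of diameter at most `α ^ k` are cliques of the threshold graph and compression keeps
    -- components connected, so excess pieces come only from the final join.
    have h1 : Q ≤ (thresholdGraph (α ^ k) Q).reachableSetoid := by
      refine leaderCompression_le_conn hQ (fun u v h => h.2.1) fun u v h => ?_
      by_cases huv : u = v
      · exact huv ▸ Setoid.refl' _ u
      · exact conn_of_adj ⟨huv, hdiam u v h, h⟩
    have h2 := numClasses_anti (h1.trans (conn_mono (thresholdGraph_mono le_rfl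
      (le_joinIncomplete (thresholdGraph (α ^ k) (mpxHierarchy δ (k + 1)))
        (mpxHierarchy δ (k + 1)) Q))))
    have h3 := numClasses_le_joinIncomplete (thresholdGraph (α ^ k) (mpxHierarchy δ (k + 1)))
      (mpxHierarchy δ (k + 1)) Q
    omega
  · gcongr
    exact ncard_incompleteSet_le _ _

/-- At the top level every edge is allowed and none can leave a set, so the last partition has one
set. -/
lemma finalHierarchy_spec (htop : ∀ u v : V, dist u v ≤ α ^ K) {r : ℕ} {H : ℕ → Setoid V}
    (hH : H ∈ (finalHierarchy σ α r δ (K + 1)).support) :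
    H 0 = ⊥ ∧ H (K + 1) = ⊤ ∧ (∀ k ≤ K, H k ≤ H (k + 1)) ∧
      ∀ k ≤ K, mpxHierarchy δ k ≤ H (k + 1) ∧ H (k + 1) ≤ mpxHierarchy δ (k + 1) ∧
        ∀ u v, dist u v ≤ α ^ k → mpxHierarchy δ (k + 1) u v → H (k + 1) u v := by
  obtain ⟨h0, h1⟩ := mem_finalHierarchy hH
  have h2 := fun k (hk : k ≤ K) => levelPartition_spec (h1 k (Nat.lt_succ_iff.2 hk))
  refine ⟨h0, eq_top_iff.2 fun u v _ => (h2 K le_rfl).2.2 u v (htop u v) ?_, fun k hk => ?_, h2⟩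
  · rw [mpxHierarchy_top δ (Nat.lt_succ_self K)]
    trivial
  · cases k with
    | zero => exact h0 ▸ bot_le
    | succ k => exact (h2 k (by omega)).2.1.trans (h2 (k + 1) hk).1

lemma isSpanningTree_of_mem_outputLaw (htop : ∀ u v : V, dist u v ≤ α ^ K) {r₁ r₂ : ℕ}
    {T : Finset (Sym2 V)} (hT : T ∈ (outputLaw σ α r₁ r₂ δ).support) : IsSpanningTree T := by
  rw [outputLaw, PMF.mem_support_bind_iff] at hT
  obtain ⟨H, hH, hT⟩ := hT
  obtain ⟨h0, h1, h2, -⟩ := finalHierarchy_spec htop hH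
  obtain ⟨g1, g2, g3⟩ := buildTree_spec h0 (fun k hk => h2 k (Nat.lt_succ_iff.1 hk)) hT
  rw [h1, numClasses_top] at g3
  exact isSpanningTree_of_connects g1 (fun R hR => top_le_iff.1 (h1 ▸ g2 R hR)) g3

/-- The mean weight of the output, given delays for which the sets of the MPX partitions have
bounded diameter. -/
lemma expect_outputLaw_le (hα : 1 < α) (htop : ∀ u v : V, dist u v ≤ α ^ K)
    (hdiam : ∀ k, ∀ u v, mpxHierarchy δ k u v → dist u v ≤ α ^ k)
    {S : Finset (Sym2 V)} (hS : Connects S) (hS1 : ∀ e ∈ S, 1 ≤ edgeWeight e) (r₁ r₂ : ℕ) :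
    expect (outputLaw σ α r₁ r₂ δ) (fun T => ENNReal.ofReal (weight T)) ≤
      ENNReal.ofReal (weight S) + ∑ j ∈ Finset.range (K + 1), ENNReal.ofReal (α ^ (j + 1)) *
        ((3 / 4) ^ r₁ * (2 * cutCount S (mpxHierarchy δ j) : ℕ) +
          cutCount S (mpxHierarchy δ (j + 2)) +
          (3 / 4) ^ r₂ * cutCount S (if j = 0 then ⊥ else mpxHierarchy δ (j - 1))) := by
  rw [outputLaw, expect_bind]
  calc _ ≤ expect (finalHierarchy σ α r₁ δ (K + 1)) (fun H => ENNReal.ofReal (weight S) +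
        ∑ j ∈ Finset.range (K + 1), ENNReal.ofReal (α ^ (j + 1)) *
          ((excess (H (j + 1)) (α ^ j) : ℝ≥0∞) + cutCount S (mpxHierarchy δ (j + 2)) +
          (3 / 4) ^ r₂ * cutCount S (if j = 0 then ⊥ else mpxHierarchy δ (j - 1)))) := by
        refine expect_mono fun H hH => ?_
        obtain ⟨h0, h1, h2, h3⟩ := finalHierarchy_spec htop hH
        refine (expect_buildTree_hierarchy_le hS hS1 hα h0 h1 h2 (fun k hk => (h3 k hk).2.2)
          (fun k hk u v h => hdiam (k + 1) u v ((h3 k hk).2.1 h)) r₂).trans ?_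
        gcongr with j hj
        have hj' := Nat.lt_succ_iff.1 (Finset.mem_range.1 hj)
        -- `H j` is the partition of level `α ^ (j - 1)`; for `j = 0` it consists of singletons.
        have h4 : (if j = 0 then ⊥ else mpxHierarchy δ (j - 1)) ≤ H j := by
          cases j with
          | zero => simp
          | succ j => simpa using (h3 j (by omega)).1
        have h5 := (numClasses_anti h4).trans (numClasses_le_cutCount hS _)
        omega
    _ ≤ _ := by
        rw [expect_add, expect_const, expect_sum]
        gcongr with j hj
        rw [expect_const_mul]
        simp only [expect_add, expect_const]
        gcongr
        rw [expect_finalHierarchy r₁ (Finset.mem_range.1 hj) fun R => (excess R (α ^ j) : ℝ≥0∞)]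
        refine (expect_excess_le (hdiam j) r₁).trans ?_
        gcongr
        have := numClasses_le_cutCount hS (mpxHierarchy δ j)
        omega

end Output

end MetricMST

namespace MetricMST

open scoped ENNReal
open MeasureTheory ProbabilityTheory

/-! ### Tails of the exponential distribution. -/

section Exponential

variable {r : ℝ}

lemma nullSingletonClass_expMeasure (r : ℝ) : NullSingletonClass (expMeasure r) :=
  ⟨fun x => (withDensity_absolutelyContinuous _ _) (measure_singleton x)⟩

lemma expMeasure_Ioi (hr : 0 < r) (x : ℝ) :
    expMeasure r (Set.Ioi x) = ENNReal.ofReal (Real.exp (-(r * max x 0))) := by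
  have := isProbabilityMeasure_expMeasure hr
  have h1 : (expMeasure r).real (Set.Iic x) = if 0 ≤ x then 1 - Real.exp (-(r * x)) else 0 := by
    rw [← cdf_eq_real, cdf_expMeasure_eq hr]
  have h2 : (expMeasure r).real (Set.Ioi x) = Real.exp (-(r * max x 0)) := by
    rw [← Set.compl_Iic, probReal_compl_eq_one_sub measurableSet_Iic, h1]
    split_ifs with hx
    · rw [max_eq_left hx]; ring
    · rw [max_eq_right (le_of_not_ge hx)]; simp
  rw [← h2, Measure.real, ENNReal.ofReal_toReal (measure_ne_top _ _)]

lemma expMeasure_Ici (hr : 0 < r) (x : ℝ) :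
    expMeasure r (Set.Ici x) = ENNReal.ofReal (Real.exp (-(r * max x 0))) := by
  have := nullSingletonClass_expMeasure r
  rw [← expMeasure_Ioi hr, measure_congr Ioi_ae_eq_Ici]

lemma expMeasure_Iio_zero (hr : 0 < r) : expMeasure r (Set.Iio 0) = 0 := by
  have := isProbabilityMeasure_expMeasure hr
  rw [← Set.compl_Ici, prob_compl_eq_one_sub measurableSet_Ici, expMeasure_Ici hr]
  simp

lemma expMeasure_Icc_compl_le (hr : 0 < r) {t : ℝ} (ht : 0 ≤ t) :
    expMeasure r (Set.Icc 0 t)ᶜ ≤ ENNReal.ofReal (Real.exp (-(r * t))) := by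
  have h : (Set.Icc 0 t)ᶜ ⊆ Set.Iio 0 ∪ Set.Ioi t := by
    intro x hx
    by_contra h
    simp only [Set.mem_union, Set.mem_Iio, Set.mem_Ioi, not_or, not_lt] at h
    exact hx h
  refine (measure_mono h).trans ((measure_union_le _ _).trans ?_)
  rw [expMeasure_Iio_zero hr, expMeasure_Ioi hr, zero_add, max_eq_left ht]

/-- The exponential distribution has no memory. -/
lemma expMeasure_forall_le {ι : Type*} (hr : 0 < r) {h : ℝ} (hh : 0 ≤ h) (s : Finset ι)
    (a : ι → ℝ) :
    ENNReal.ofReal (Real.exp (-(r * h))) * expMeasure r {y | ∀ x ∈ s, a x ≤ y} ≤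
      expMeasure r {y | ∀ x ∈ s, a x + h ≤ y} := by
  rcases s.eq_empty_or_nonempty with rfl | hs
  · have := isProbabilityMeasure_expMeasure hr
    simp only [Finset.notMem_empty, false_imp_iff, implies_true, Set.ofPred_true, measure_univ,
      mul_one]
    rw [ENNReal.ofReal_le_one, Real.exp_le_one_iff]
    have := mul_nonneg hr.le hh
    linarith
  · obtain ⟨x, hx, hmax⟩ := s.exists_max_image a hs
    have h1 : {y | ∀ x ∈ s, a x ≤ y} = Set.Ici (a x) :=
      Set.ext fun y => ⟨fun hy => hy x hx, fun hy z hz => (hmax z hz).trans hy⟩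
    have h2 : {y | ∀ x ∈ s, a x + h ≤ y} = Set.Ici (a x + h) :=
      Set.ext fun y => ⟨fun hy => hy x hx, fun hy z hz => by
        have := hmax z hz
        have hy : a x + h ≤ y := hy
        linarith⟩
    rw [h1, h2, expMeasure_Ici hr, expMeasure_Ici hr, ← ENNReal.ofReal_mul (Real.exp_nonneg _),
      ← Real.exp_add]
    refine ENNReal.ofReal_le_ofReal (Real.exp_le_exp.2 ?_)
    -- Only an inequality, since a negative threshold may be raised up to 0 at no cost.
    have h3 : max (a x + h) 0 ≤ h + max (a x) 0 := by
      refine max_le ?_ (add_nonneg hh (le_max_right _ _))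
      linarith [le_max_left (a x) 0]
    nlinarith

end Exponential

/-! ### Integrating one coordinate of a product first. -/

section Product

variable {ι : Type*} [Fintype ι] [DecidableEq ι] {X : ι → Type*} [∀ i, MeasurableSpace (X i)]
  {μ : ∀ i, Measure (X i)} [∀ i, SigmaFinite (μ i)] [∀ i, Nonempty (X i)]

/-- Integrals over a product are compared by integrating one coordinate first. -/
lemma lintegral_pi_le_of_coordinate {f g : (∀ i, X i) → ℝ≥0∞} (hf : Measurable f)
    (hg : Measurable g) (i : ι)
    (h : ∀ x, ∫⁻ y, f (Function.update x i y) ∂μ i ≤ ∫⁻ y, g (Function.update x i y) ∂μ i) :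
    ∫⁻ x, f x ∂Measure.pi μ ≤ ∫⁻ x, g x ∂Measure.pi μ := by
  have x₀ : ∀ i, X i := fun i => Classical.arbitrary _
  rw [lintegral_eq_lmarginal_univ x₀, lintegral_eq_lmarginal_univ x₀,
    lmarginal_erase' f hf (Finset.mem_univ i), lmarginal_erase' g hg (Finset.mem_univ i)]
  exact lmarginal_mono h x₀

end Product

/-! ### Cut probability and measurability of the MPX centres. -/

section Delays

variable {V : Type*} [Fintype V] [Nonempty V] [MetricSpace V] {K : ℕ}

lemma mpxCenter_spec (δ : V → ℝ) (u v : V) :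
    dist u (mpxCenter δ u) - δ (mpxCenter δ u) ≤ dist u v - δ v :=
  Classical.choose_spec (Finite.exists_min fun v => dist u v - δ v) v

variable {rate : Fin (K + 1) × V → ℝ}

/-- The law of independent exponential delays with given rates. -/
noncomputable abbrev delayLaw (rate : Fin (K + 1) × V → ℝ) : Measure (Fin (K + 1) × V → ℝ) :=
  Measure.pi fun p => expMeasure (rate p)

lemma ae_no_ties (hrate : ∀ p, 0 < rate p) : ∀ᵐ δ ∂(delayLaw rate),
    ∀ (i : Fin (K + 1)) (u x y : V), x ≠ y → dist u x - δ (i, x) ≠ dist u y - δ (i, y) := by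
  classical
  have := fun p => isProbabilityMeasure_expMeasure (hrate p)
  simp only [ae_all_iff]
  intro i u x y hxy
  have hm : MeasurableSet {δ : Fin (K + 1) × V → ℝ |
      dist u x - δ (i, x) = dist u y - δ (i, y)} :=
    measurableSet_eq_fun (by fun_prop) (by fun_prop)
  rw [ae_iff]
  simp only [ne_eq, not_not]
  rw [← lintegral_indicator_one hm]
  refine le_antisymm ?_ zero_le
  refine (lintegral_pi_le_of_coordinate (g := 0) (measurable_one.indicator hm) measurable_const
    (i, x) fun δ => ?_).trans (by simp)
  have h1 : ∀ z, ({δ : Fin (K + 1) × V → ℝ | dist u x - δ (i, x) =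
      dist u y - δ (i, y)}).indicator (1 : (Fin (K + 1) × V → ℝ) → ℝ≥0∞) (Function.update δ (i, x) z) =
      ({dist u x - dist u y + δ (i, y)} : Set ℝ).indicator 1 z := by
    intro z
    simp only [Set.indicator_apply, Set.mem_ofPred_eq, Function.update_self, Pi.one_apply,
      Function.update_of_ne (show (i, y) ≠ (i, x) by simpa using hxy.symm), Set.mem_singleton_iff]
    congr 1
    apply propext
    constructor <;> intro h <;> linarith
  simp only [h1]
  have := nullSingletonClass_expMeasure (rate (i, x))
  rw [lintegral_indicator_one (measurableSet_singleton _), measure_singleton]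
  exact zero_le

/-- The centres of all vertices at all levels. -/
noncomputable def centers (δ : Fin (K + 1) × V → ℝ) (p : Fin (K + 1) × V) : V :=
  mpxCenter (fun v => δ (p.1, v)) p.2

/-- The centre breaks ties by an arbitrary choice, so only null measurability is claimed: off the
null set of ties, being the centre is a closed condition. As `centers` has finitely many values,
every function of the centres is then almost everywhere measurable. -/
lemma nullMeasurableSet_centers_eq (hrate : ∀ p, 0 < rate p) (c : Fin (K + 1) × V → V) :
    NullMeasurableSet {δ | centers δ = c} (delayLaw rate) := by
  have h : {δ : Fin (K + 1) × V → ℝ | centers δ = c} =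
      ⋂ p : Fin (K + 1) × V, {δ | centers δ p = c p} := by
    ext δ
    simp [funext_iff]
  rw [h]
  refine NullMeasurableSet.iInter fun p => ?_
  have hm : MeasurableSet {δ : Fin (K + 1) × V → ℝ | ∀ x,
      dist p.2 (c p) - δ (p.1, c p) ≤ dist p.2 x - δ (p.1, x)} := by
    simp only [Set.ofPred_forall]
    exact MeasurableSet.iInter fun x => measurableSet_le (by fun_prop) (by fun_prop)
  refine hm.nullMeasurableSet.congr ?_
  filter_upwards [ae_no_ties hrate] with δ hδ
  apply propext
  have h1 := mpxCenter_spec (fun v => δ (p.1, v)) p.2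
  constructor
  · intro h2
    by_contra hne
    exact hδ p.1 p.2 _ _ hne (le_antisymm (h1 (c p)) (h2 _))
  · intro h2
    change centers δ p = c p at h2
    change ∀ x, _ ≤ _
    rw [← h2]
    exact h1

open scoped Classical in
lemma comp_centers_eq {M : Type*} [AddCommMonoid M] (g : (Fin (K + 1) × V → V) → M) :
    (fun δ => g (centers δ)) = fun δ : Fin (K + 1) × V → ℝ =>
      ∑ c : Fin (K + 1) × V → V, {δ | centers δ = c}.indicator (fun _ => g c) δ := by
  classical
  funext δ
  simp [Set.indicator_apply]

lemma aemeasurable_comp_centers (hrate : ∀ p, 0 < rate p)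
    (g : (Fin (K + 1) × V → V) → ℝ≥0∞) :
    AEMeasurable (fun δ => g (centers δ)) (delayLaw rate) := by
  classical
  rw [comp_centers_eq]
  exact Finset.aemeasurable_fun_sum _ fun c _ =>
    aemeasurable_const.indicator₀ (nullMeasurableSet_centers_eq hrate c)

lemma integrable_comp_centers (hrate : ∀ p, 0 < rate p) (g : (Fin (K + 1) × V → V) → ℝ) :
    Integrable (fun δ => g (centers δ)) (delayLaw rate) := by
  classical
  have := fun p => isProbabilityMeasure_expMeasure (hrate p)
  rw [comp_centers_eq]
  exact integrable_finsetSum _ fun c _ =>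
    (integrable_const _).indicator₀ (nullMeasurableSet_centers_eq hrate c)

/-- Close vertices rarely have different centres. -/
lemma measure_centers_ne_le (hrate : ∀ p, 0 < rate p) (i : Fin (K + 1)) {r : ℝ}
    (hr : ∀ v, rate (i, v) = r) (u v : V) :
    delayLaw rate {δ | centers δ (i, u) ≠ centers δ (i, v)} ≤
      ENNReal.ofReal (3 * r * dist u v) := by
  classical
  rcases eq_or_ne u v with rfl | huv
  · simp
  have hr0 : 0 < r := hr u ▸ hrate (i, u)
  have := fun p => isProbabilityMeasure_expMeasure (hrate p)
  have hd : 0 < dist u v := dist_pos.2 huv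
  -- From `u`, the shifted distance to `c` beats all others by at least `h`.
  let gap : V → ℝ → Set (Fin (K + 1) × V → ℝ) := fun c h =>
    {δ | ∀ x ∈ Finset.univ.erase c, (dist u c - dist u x + δ (i, x)) + h ≤ δ (i, c)}
  have hgm : ∀ c h, MeasurableSet (gap c h) := by
    intro c h
    simp only [gap, Set.ofPred_forall]
    exact MeasurableSet.iInter fun x => MeasurableSet.iInter fun _ =>
      measurableSet_le (by fun_prop) (by fun_prop)
  have hmem : ∀ {c h x} {δ : Fin (K + 1) × V → ℝ}, δ ∈ gap c h → x ≠ c →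
      (dist u c - dist u x + δ (i, x)) + h ≤ δ (i, c) := fun hδ hx =>
    hδ _ (Finset.mem_erase.2 ⟨hx, Finset.mem_univ _⟩)
  -- With the other delays fixed, the event is a lower bound on the delay of `c`; the memoryless
  -- property gives the cost of raising that bound.
  have hstep : ∀ c, ENNReal.ofReal (Real.exp (-(r * (3 * dist u v)))) *
      delayLaw rate (gap c 0) ≤ delayLaw rate (gap c (3 * dist u v)) := by
    intro c
    rw [← lintegral_indicator_one (hgm c _), ← lintegral_indicator_one (hgm c _),
      ← lintegral_const_mul _ (measurable_one.indicator (hgm c _))]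
    refine lintegral_pi_le_of_coordinate
      ((measurable_one.indicator (hgm c _)).const_mul _) (measurable_one.indicator (hgm c _))
      (i, c) fun δ => ?_
    have h1 : ∀ h z, (gap c h).indicator (1 : (Fin (K + 1) × V → ℝ) → ℝ≥0∞) (Function.update δ (i, c) z) =
        {y | ∀ x ∈ Finset.univ.erase c,
          (dist u c - dist u x + δ (i, x)) + h ≤ y}.indicator 1 z := by
      intro h z
      simp only [Set.indicator_apply, Pi.one_apply]
      congr 1
      apply propext
      simp only [gap, Set.mem_ofPred_eq, Function.update_self]
      refine forall₂_congr fun x hx => ?_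
      rw [Function.update_of_ne (by simpa using (Finset.mem_erase.1 hx).1)]
    have h2 : ∀ h, MeasurableSet {y : ℝ | ∀ x ∈ Finset.univ.erase c,
        (dist u c - dist u x + δ (i, x)) + h ≤ y} := by
      intro h
      simp only [Set.ofPred_forall]
      exact MeasurableSet.iInter fun x => MeasurableSet.iInter fun _ => measurableSet_Ici
    simp only [h1]
    rw [lintegral_const_mul _ (measurable_one.indicator (h2 _)), lintegral_indicator_one (h2 _),
      lintegral_indicator_one (h2 _), hr]
    simpa only [add_zero] using expMeasure_forall_le hr0 (by positivity : 0 ≤ 3 * dist u v)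
      (Finset.univ.erase c) fun x => dist u c - dist u x + δ (i, x)
  have hcover : (1 : ℝ≥0∞) ≤ ∑ c, delayLaw rate (gap c 0) := by
    have h1 : (⋃ c ∈ (Finset.univ : Finset V), gap c 0) = Set.univ := by
      refine Set.eq_univ_of_forall fun δ => ?_
      simp only [Finset.mem_univ, Set.iUnion_true, Set.mem_iUnion]
      refine ⟨centers δ (i, u), fun x _ => ?_⟩
      have := mpxCenter_spec (fun v => δ (i, v)) u x
      simp only [centers]
      linarith
    rw [← measure_univ (μ := delayLaw rate), ← h1]
    exact measure_biUnion_finset_le _ _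
  have hdisj : Pairwise (Function.onFun Disjoint fun c => gap c (3 * dist u v)) := by
    intro c c' hne
    refine Set.disjoint_left.2 fun δ h h' => ?_
    have h1 := hmem h hne.symm
    have h2 := hmem h' hne
    linarith
  have hbig : ENNReal.ofReal (Real.exp (-(r * (3 * dist u v)))) ≤
      delayLaw rate (⋃ c, gap c (3 * dist u v)) := by
    rw [measure_iUnion hdisj fun c => hgm c _, tsum_fintype]
    calc _ ≤ ENNReal.ofReal (Real.exp (-(r * (3 * dist u v)))) *
          ∑ c, delayLaw rate (gap c 0) := le_mul_of_one_le_right' hcover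
      _ ≤ _ := by
          rw [Finset.mul_sum]
          exact Finset.sum_le_sum fun c _ => hstep c
  -- Going from `u` to `v` changes a difference of two distances by at most `2 * dist u v`. The
  -- margin 3 keeps the inequality strict, so ties need no care.
  have hsub : {δ : Fin (K + 1) × V → ℝ | centers δ (i, u) ≠ centers δ (i, v)} ⊆
      (⋃ c, gap c (3 * dist u v))ᶜ := by
    intro δ hδ hgap
    obtain ⟨c, hc⟩ := Set.mem_iUnion.1 hgap
    have h1 : centers δ (i, u) = c := by
      by_contra hne
      have h2 := hmem hc hne
      have h3 := mpxCenter_spec (fun v => δ (i, v)) u c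
      simp only [centers] at h2
      linarith
    have h2 : centers δ (i, v) = c := by
      by_contra hne
      have h2 := hmem hc hne
      have h3 := mpxCenter_spec (fun v => δ (i, v)) v c
      have h4 := dist_triangle u v (centers δ (i, v))
      have h5 := dist_triangle v u c
      rw [dist_comm v u] at h5
      simp only [centers] at h2 h4
      linarith
    exact hδ (h1.trans h2.symm)
  refine (measure_mono hsub).trans ?_
  rw [prob_compl_eq_one_sub (MeasurableSet.iUnion fun c => hgm c _)]
  refine (tsub_le_tsub_left hbig 1).trans ?_
  rw [← ENNReal.ofReal_one, ← ENNReal.ofReal_sub _ (Real.exp_nonneg _)]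
  refine ENNReal.ofReal_le_ofReal ?_
  have := Real.add_one_le_exp (-(r * (3 * dist u v)))
  linarith

end Delays

end MetricMST

namespace MetricMST

open scoped ENNReal
open MeasureTheory ProbabilityTheory

/-! ### Averaging over the delays. -/

section Integration

variable {V : Type*} [Fintype V] [Nonempty V] [MetricSpace V] {σ : Choices V} {K : ℕ} {α ρ : ℝ}

lemma mpxHierarchy_congr {δ δ' : Fin (K + 1) × V → ℝ} (h : centers δ = centers δ') :
    mpxHierarchy δ = mpxHierarchy δ' := by
  have h1 : ∀ i, (mpxDecomposition fun v => δ (i, v)) = mpxDecomposition fun v => δ' (i, v) := by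
    intro i
    have : (mpxCenter fun v => δ (i, v)) = mpxCenter fun v => δ' (i, v) :=
      funext fun u => congrFun h (i, u)
    rw [mpxDecomposition, mpxDecomposition, this]
  funext k
  simp only [mpxHierarchy, h1]

lemma finalHierarchy_congr {δ δ' : Fin (K + 1) × V → ℝ} (h : centers δ = centers δ') (r m : ℕ) :
    finalHierarchy σ α r δ m = finalHierarchy σ α r δ' m := by
  induction m with
  | zero => rfl
  | succ m ih =>
    have h1 : levelPartition σ α r δ m = levelPartition σ α r δ' m := by
      simp only [levelPartition, mpxHierarchy_congr h]
    rw [finalHierarchy, finalHierarchy, ih, h1]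

lemma outputLaw_congr {δ δ' : Fin (K + 1) × V → ℝ} (h : centers δ = centers δ') (r₁ r₂ : ℕ) :
    outputLaw σ α r₁ r₂ δ = outputLaw σ α r₁ r₂ δ' := by
  rw [outputLaw, outputLaw, finalHierarchy_congr h]

lemma aemeasurable_of_centers {rate : Fin (K + 1) × V → ℝ} (hrate : ∀ p, 0 < rate p)
    {f : (Fin (K + 1) × V → ℝ) → ℝ≥0∞} (hf : ∀ δ δ', centers δ = centers δ' → f δ = f δ') :
    AEMeasurable f (delayLaw rate) := by
  have h : f = fun δ => Function.extend centers f 0 (centers δ) :=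
    funext fun δ => (Function.FactorsThrough.extend_apply (f := centers) (g := f)
      (fun _ _ h => hf _ _ h) 0 δ).symm
  rw [h]
  exact aemeasurable_comp_centers hrate _

lemma integrable_of_centers {rate : Fin (K + 1) × V → ℝ} (hrate : ∀ p, 0 < rate p)
    {f : (Fin (K + 1) × V → ℝ) → ℝ} (hf : ∀ δ δ', centers δ = centers δ' → f δ = f δ') :
    Integrable f (delayLaw rate) := by
  have h : f = fun δ => Function.extend centers f 0 (centers δ) :=
    funext fun δ => (Function.FactorsThrough.extend_apply (f := centers) (g := f)
      (fun _ _ h => hf _ _ h) 0 δ).symm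
  rw [h]
  exact integrable_comp_centers hrate _

lemma integrable_meanWeight {rate : Fin (K + 1) × V → ℝ} (hrate : ∀ p, 0 < rate p)
    (r₁ r₂ : ℕ) : Integrable (fun δ => meanWeight σ α r₁ r₂ δ) (delayLaw rate) :=
  integrable_of_centers hrate fun δ δ' h => by rw [meanWeight, meanWeight, outputLaw_congr h]

lemma ofReal_meanWeight (δ : Fin (K + 1) × V → ℝ) (r₁ r₂ : ℕ) :
    ENNReal.ofReal (meanWeight σ α r₁ r₂ δ) =
      expect (outputLaw σ α r₁ r₂ δ) fun T => ENNReal.ofReal (weight T) := by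
  rw [meanWeight, expect, tsum_fintype, ENNReal.ofReal_sum_of_nonneg fun T _ =>
    mul_nonneg ENNReal.toReal_nonneg (weight_nonneg T)]
  refine Finset.sum_congr rfl fun T _ => ?_
  rw [ENNReal.ofReal_mul ENNReal.toReal_nonneg, ENNReal.ofReal_toReal (PMF.apply_ne_top _ _)]

lemma meanWeight_nonneg (δ : Fin (K + 1) × V → ℝ) (r₁ r₂ : ℕ) : 0 ≤ meanWeight σ α r₁ r₂ δ :=
  Finset.sum_nonneg fun T _ => mul_nonneg ENNReal.toReal_nonneg (weight_nonneg T)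

lemma mpxHierarchy_rel_of_centers {δ : Fin (K + 1) × V → ℝ} {k : ℕ} {u v : V}
    (h : ∀ i : Fin (K + 1), k ≤ i → centers δ (i, u) = centers δ (i, v)) :
    mpxHierarchy δ k u v := by
  -- The partition that identifies only `u` and `v`, so that the infimum can be handled by its
  -- universal property.
  have h1 : (Setoid.mk (fun x y : V => (x = u ∨ x = v) ∧ (y = u ∨ y = v) ∨ x = y)
      ⟨fun _ => Or.inr rfl, by tauto, by
        rintro x y z (h | rfl) (h' | rfl) <;> tauto⟩) ≤ mpxHierarchy δ k := by
    refine le_iInf fun i => le_iInf fun hi => ?_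
    have h2 : mpxCenter (fun w => δ (i, w)) u = mpxCenter (fun w => δ (i, w)) v := h i hi
    rintro x y (⟨rfl | rfl, rfl | rfl⟩ | rfl)
    · rfl
    · exact h2
    · exact h2.symm
    · rfl
    · rfl
  exact h1 (Or.inl ⟨Or.inl rfl, Or.inr rfl⟩)

lemma cutCount_le_sum (S : Finset (Sym2 V)) (δ : Fin (K + 1) × V → ℝ) (k : ℕ) :
    (cutCount S (mpxHierarchy δ k) : ℝ≥0∞) ≤ ∑ e ∈ S, ∑ i : Fin (K + 1), if k ≤ (i : ℕ) then
      {δ | ∃ u v, e = s(u, v) ∧ centers δ (i, u) ≠ centers δ (i, v)}.indicator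
        (fun _ => (1 : ℝ≥0∞)) δ else 0 := by
  classical
  rw [cutCount, Finset.card_filter]
  push_cast
  refine Finset.sum_le_sum fun e _ => ?_
  split_ifs with he
  · obtain ⟨u, v, rfl, huv⟩ := he
    have h1 : ∃ i : Fin (K + 1), k ≤ i ∧ centers δ (i, u) ≠ centers δ (i, v) := by
      by_contra! h
      exact huv (mpxHierarchy_rel_of_centers h)
    obtain ⟨i, hi, hne⟩ := h1
    refine le_trans (le_of_eq ?_) (Finset.single_le_sum (f := fun i : Fin (K + 1) =>
      if k ≤ (i : ℕ) then {δ | ∃ u' v', s(u, v) = s(u', v') ∧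
        centers δ (i, u') ≠ centers δ (i, v')}.indicator (fun _ => (1 : ℝ≥0∞)) δ else 0)
      (fun _ _ => zero_le) (Finset.mem_univ i))
    simp only [if_pos hi]
    rw [Set.indicator_of_mem]
    exact ⟨u, v, rfl, hne⟩
  · exact zero_le

lemma cutCount_le_card (S : Finset (Sym2 V)) (R : Setoid V) : cutCount S R ≤ S.card := by
  classical
  exact Finset.card_filter_le _ _

lemma geometric_tail_le (hα : 2 ≤ α) (K k : ℕ) :
    ∑ i ∈ Finset.range (K + 1), (if k ≤ i then 1 / α ^ i else 0) ≤ 2 / α ^ k := by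
  have hα0 : 0 < α := by linarith
  have h1 : ∑ i ∈ Finset.range (K + 1), (if k ≤ i then 1 / α ^ i else 0) =
      ∑ i ∈ Finset.Ico k (K + 1), (1 / α) ^ i := by
    rw [← Finset.sum_filter]
    refine Finset.sum_congr ?_ fun i _ => by rw [one_div_pow]
    ext i
    simp only [Finset.mem_filter, Finset.mem_range, Finset.mem_Ico]
    tauto
  have h2 : 1 / α ≤ 1 / 2 := one_div_le_one_div_of_le two_pos hα
  rw [h1]
  refine (geom_sum_Ico_le_of_lt_one (by positivity) (by linarith)).trans ?_
  rw [one_div_pow, div_le_iff₀ (by linarith)]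
  have h3 : 0 ≤ 1 / α ^ k := by positivity
  have h4 : 2 / α ^ k = 2 * (1 / α ^ k) := by ring
  rw [h4]
  nlinarith

/-- The law of the delays has rate `ρ / t` at level `t`. -/
noncomputable abbrev levelRate (α ρ : ℝ) (p : Fin (K + 1) × V) : ℝ := ρ / α ^ (p.1 : ℕ)

/-- The mean number of edges cut by the nested MPX partitions. -/
lemma lintegral_cutCount_le (hα : 2 ≤ α) (hρ : 0 < ρ) (S : Finset (Sym2 V)) (k : ℕ) :
    ∫⁻ δ, (cutCount S (mpxHierarchy δ k) : ℝ≥0∞)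
      ∂(delayLaw (levelRate α ρ : Fin (K + 1) × V → ℝ)) ≤
      ENNReal.ofReal (6 * ρ * weight S / α ^ k) := by
  classical
  have hα0 : 0 < α := by linarith
  have hrate : ∀ p : Fin (K + 1) × V, 0 < levelRate α ρ p := fun p => by
    unfold levelRate; positivity
  have hmeas : ∀ (e : Sym2 V) (i : Fin (K + 1)), AEMeasurable (fun δ => if k ≤ (i : ℕ) then
      {δ | ∃ u v, e = s(u, v) ∧ centers δ (i, u) ≠ centers δ (i, v)}.indicator
        (fun _ => (1 : ℝ≥0∞)) δ else 0) (delayLaw (levelRate α ρ : Fin (K + 1) × V → ℝ)) :=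
    fun e i => aemeasurable_of_centers hrate fun δ δ' h => by
      simp only [Set.indicator_apply, Set.mem_ofPred_eq, h]
  refine (lintegral_mono fun δ => cutCount_le_sum S δ k).trans ?_
  rw [lintegral_finsetSum' _ fun e _ => Finset.aemeasurable_fun_sum _ fun i _ => hmeas e i]
  have hterm : ∀ e ∈ S, ∫⁻ δ, (∑ i : Fin (K + 1), if k ≤ (i : ℕ) then
      {δ | ∃ u v, e = s(u, v) ∧ centers δ (i, u) ≠ centers δ (i, v)}.indicator
        (fun _ => (1 : ℝ≥0∞)) δ else 0) ∂(delayLaw (levelRate α ρ : Fin (K + 1) × V → ℝ)) ≤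
      ENNReal.ofReal (6 * ρ / α ^ k * edgeWeight e) := by
    intro e _
    rw [lintegral_finsetSum' _ fun i _ => hmeas e i]
    have h1 : ∀ i : Fin (K + 1), ∫⁻ δ, (if k ≤ (i : ℕ) then
        {δ | ∃ u v, e = s(u, v) ∧ centers δ (i, u) ≠ centers δ (i, v)}.indicator
          (fun _ => (1 : ℝ≥0∞)) δ else 0) ∂(delayLaw (levelRate α ρ : Fin (K + 1) × V → ℝ)) ≤
        ENNReal.ofReal (if k ≤ (i : ℕ) then 3 * (ρ / α ^ (i : ℕ)) * edgeWeight e else 0) := by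
      intro i
      split_ifs with hi
      · refine (lintegral_indicator_const_le _ _).trans ?_
        rw [one_mul]
        induction e using Sym2.inductionOn with
        | hf u v =>
          refine (measure_mono ?_).trans (measure_centers_ne_le hrate i (fun _ => rfl) u v)
          rintro δ ⟨u', v', he, hne⟩
          rcases Sym2.eq_iff.1 he with ⟨rfl, rfl⟩ | ⟨rfl, rfl⟩
          · exact hne
          · exact Ne.symm hne
      · simp
    refine (Finset.sum_le_sum fun i _ => h1 i).trans ?_
    have hw := edgeWeight_nonneg e
    rw [← ENNReal.ofReal_sum_of_nonneg fun i _ => by split_ifs <;> positivity]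
    refine ENNReal.ofReal_le_ofReal ?_
    rw [Fin.sum_univ_eq_sum_range (fun i => if k ≤ i then 3 * (ρ / α ^ i) * edgeWeight e else 0)]
    have h2 := mul_le_mul_of_nonneg_left (geometric_tail_le hα K k)
      (by positivity : 0 ≤ 3 * ρ * edgeWeight e)
    rw [Finset.mul_sum] at h2
    calc _ = ∑ i ∈ Finset.range (K + 1), 3 * ρ * edgeWeight e *
          (if k ≤ i then 1 / α ^ i else 0) := by
          refine Finset.sum_congr rfl fun i _ => ?_
          split_ifs <;> ring
      _ ≤ _ := h2
      _ = _ := by ring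
  refine (Finset.sum_le_sum hterm).trans ?_
  rw [← ENNReal.ofReal_sum_of_nonneg fun e _ => by
    have := edgeWeight_nonneg e
    positivity, ← Finset.mul_sum]
  refine le_of_eq ?_
  congr 1
  rw [weight]
  ring

/-- The delays that are too long for some level, or negative. -/
def badDelays (α : ℝ) : Set (Fin (K + 1) × V → ℝ) :=
  ⋃ p : Fin (K + 1) × V, {δ | δ p ∈ (Set.Icc 0 (α ^ (p.1 : ℕ) / 2))ᶜ}

lemma measurableSet_badDelays (α : ℝ) :
    MeasurableSet (badDelays α : Set (Fin (K + 1) × V → ℝ)) :=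
  MeasurableSet.iUnion fun p => measurableSet_Icc.compl.preimage (measurable_pi_apply p)

lemma measure_badDelays_le (hα : 0 < α) (hρ : 0 < ρ) :
    delayLaw (levelRate α ρ : Fin (K + 1) × V → ℝ) (badDelays α) ≤
      ENNReal.ofReal ((K + 1) * Fintype.card V * Real.exp (-(ρ / 2))) := by
  have hrate : ∀ p : Fin (K + 1) × V, 0 < levelRate α ρ p := fun p => by
    unfold levelRate; positivity
  have := fun p => isProbabilityMeasure_expMeasure (hrate p)
  refine (measure_iUnion_le _).trans ?_
  rw [tsum_fintype]
  have h : ∀ p : Fin (K + 1) × V, delayLaw (levelRate α ρ : Fin (K + 1) × V → ℝ)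
      {δ | δ p ∈ (Set.Icc 0 (α ^ (p.1 : ℕ) / 2))ᶜ} ≤ ENNReal.ofReal (Real.exp (-(ρ / 2))) := by
    intro p
    have h1 := (measurePreserving_eval (fun p => expMeasure (levelRate α ρ p)) p).measure_preimage
      (measurableSet_Icc.compl : MeasurableSet (Set.Icc 0 (α ^ (p.1 : ℕ) / 2))ᶜ).nullMeasurableSet
    refine (le_of_eq h1).trans ((expMeasure_Icc_compl_le (hrate p) (by positivity)).trans
      (le_of_eq ?_))
    congr 3
    unfold levelRate
    field_simp
  refine (Finset.sum_le_sum fun p _ => h p).trans (le_of_eq ?_)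
  rw [Finset.sum_const, Finset.card_univ, Fintype.card_prod, Fintype.card_fin, nsmul_eq_mul,
    ENNReal.ofReal_mul (by positivity)]
  congr 1
  rw [← ENNReal.ofReal_natCast]
  push_cast
  rfl

/-- Comparing a vertex with itself as centre shows that its centre lies within the largest delay,
here half of `α ^ k`. -/
lemma dist_le_of_notMem_badDelays (htop : ∀ u v : V, dist u v ≤ α ^ K) (hα : 1 ≤ α)
    {δ : Fin (K + 1) × V → ℝ} (hδ : δ ∉ badDelays α) (k : ℕ) (u v : V)
    (h : mpxHierarchy δ k u v) : dist u v ≤ α ^ k := by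
  rcases Nat.lt_or_ge K k with hk | hk
  · exact (htop u v).trans (pow_le_pow_right₀ hα hk.le)
  · set i : Fin (K + 1) := ⟨k, Nat.lt_succ_iff.2 hk⟩
    have hδ' : ∀ x, 0 ≤ δ (i, x) ∧ δ (i, x) ≤ α ^ k / 2 := by
      intro x
      by_contra hx
      exact hδ (Set.mem_iUnion.2 ⟨(i, x), hx⟩)
    have h1 : ∀ x, dist x (mpxCenter (fun w => δ (i, w)) x) ≤ α ^ k / 2 := by
      intro x
      have h2 := mpxCenter_spec (fun w => δ (i, w)) x x
      rw [dist_self] at h2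
      linarith [(hδ' x).1, (hδ' (mpxCenter (fun w => δ (i, w)) x)).2]
    have h3 : mpxCenter (fun w => δ (i, w)) u = mpxCenter (fun w => δ (i, w)) v :=
      mpxHierarchy_le δ i h
    have h4 := dist_triangle_right u v (mpxCenter (fun w => δ (i, w)) u)
    have h5 := h1 u
    have h6 := h1 v
    rw [← h3] at h6
    linarith

lemma three_quarters_pow (r : ℕ) : (3 / 4 : ℝ≥0∞) ^ r = ENNReal.ofReal ((3 / 4) ^ r) := by
  rw [ENNReal.ofReal_pow (by norm_num), ENNReal.ofReal_div_of_pos (by norm_num)]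
  norm_num

/-- The mean weight of the output. -/
lemma lintegral_expect_outputLaw_le (hα : 2 ≤ α) (hρ : 0 < ρ)
    (htop : ∀ u v : V, dist u v ≤ α ^ K) {W : ℝ} (hV : ∀ u v : V, u ≠ v → 1 ≤ dist u v ∧ dist u v ≤ W)
    {S : Finset (Sym2 V)} (hS : IsSpanningTree S) (r₁ r₂ : ℕ) :
    ∫⁻ δ, expect (outputLaw σ α r₁ r₂ δ) (fun T => ENNReal.ofReal (weight T))
      ∂(delayLaw (levelRate α ρ : Fin (K + 1) × V → ℝ)) ≤
    ENNReal.ofReal (weight S) + ENNReal.ofReal ((K + 1) * (weight S *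
      ((3 / 4) ^ r₁ * (12 * ρ * α) + 6 * ρ / α + (3 / 4) ^ r₂ * (6 * ρ * α ^ 2 + α)))) +
      ENNReal.ofReal ((Fintype.card V - 1) * W) *
        ENNReal.ofReal ((K + 1) * Fintype.card V * Real.exp (-(ρ / 2))) := by
  have hα0 : 0 < α := by linarith
  have hrate : ∀ p : Fin (K + 1) × V, 0 < levelRate α ρ p := fun p => by
    unfold levelRate; positivity
  have := fun p => isProbabilityMeasure_expMeasure (hrate p)
  have hw := weight_nonneg S
  have hS1 := hS.one_le_edgeWeight fun u v h => (hV u v h).1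
  let c : ℕ → (Fin (K + 1) × V → ℝ) → ℝ≥0∞ := fun k δ => (cutCount S (mpxHierarchy δ k) : ℝ≥0∞)
  let c' : ℕ → (Fin (K + 1) × V → ℝ) → ℝ≥0∞ := fun j δ =>
    (cutCount S (if j = 0 then ⊥ else mpxHierarchy δ (j - 1)) : ℝ≥0∞)
  have hc : ∀ k, AEMeasurable (c k) (delayLaw (levelRate α ρ)) := fun k =>
    aemeasurable_of_centers hrate fun δ δ' h => by simp only [c, mpxHierarchy_congr h]
  have hc' : ∀ k, AEMeasurable (c' k) (delayLaw (levelRate α ρ)) := fun k =>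
    aemeasurable_of_centers hrate fun δ δ' h => by simp only [c', mpxHierarchy_congr h]
  have hci : ∀ k, ∫⁻ δ, c k δ ∂(delayLaw (levelRate α ρ)) ≤
      ENNReal.ofReal (6 * ρ * weight S / α ^ k) := lintegral_cutCount_le hα hρ S
  have hci' : ∀ j, ENNReal.ofReal (α ^ (j + 1)) * ∫⁻ δ, c' j δ ∂(delayLaw (levelRate α ρ)) ≤
      ENNReal.ofReal (weight S * (6 * ρ * α ^ 2 + α)) := by
    intro j
    cases j with
    | zero =>
      -- Singletons cut all of `S`, but its edges have weight at least 1; this is the source of the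
      -- extra `α`.
      have h1 : ∀ δ, c' 0 δ ≤ ENNReal.ofReal (weight S) := by
        intro δ
        have h2 : c' 0 δ ≤ (S.card : ℝ≥0∞) := Nat.cast_le.2 (cutCount_le_card S _)
        refine h2.trans ?_
        rw [← ENNReal.ofReal_natCast]
        exact ENNReal.ofReal_le_ofReal (card_le_weight hS1)
      refine (mul_le_mul_right (lintegral_mono h1) _).trans ?_
      rw [lintegral_const, measure_univ, mul_one, ← ENNReal.ofReal_mul (by positivity)]
      refine ENNReal.ofReal_le_ofReal ?_
      have : 0 ≤ weight S * (6 * ρ * α ^ 2) := by positivity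
      rw [zero_add, pow_one]
      linarith
    | succ j =>
      have h1 : ∀ δ, c' (j + 1) δ = c j δ := fun δ => by simp [c, c']
      simp only [h1]
      refine (mul_le_mul_right (hci j) _).trans ?_
      rw [← ENNReal.ofReal_mul (by positivity)]
      refine ENNReal.ofReal_le_ofReal ?_
      have h2 : α ^ (j + 1 + 1) * (6 * ρ * weight S / α ^ j) = weight S * (6 * ρ * α ^ 2) := by
        field_simp
        ring
      have h3 : 0 ≤ weight S * α := by positivity
      rw [h2]
      linarith
  calc _ ≤ ∫⁻ δ, ((ENNReal.ofReal (weight S) + ∑ j ∈ Finset.range (K + 1),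
        ENNReal.ofReal (α ^ (j + 1)) * ((3 / 4) ^ r₁ * (2 * c j δ) + c (j + 2) δ +
          (3 / 4) ^ r₂ * c' j δ)) + (badDelays α).indicator
            (fun _ => ENNReal.ofReal ((Fintype.card V - 1) * W)) δ)
        ∂(delayLaw (levelRate α ρ)) := by
        refine lintegral_mono fun δ => ?_
        by_cases hδ : δ ∈ badDelays α
        -- For bad delays the only bound used is that the output is a spanning tree.
        · refine le_trans (expect_le_of_le fun T hT => ?_) le_add_self
          rw [Set.indicator_of_mem hδ]
          exact ENNReal.ofReal_le_ofReal
            ((isSpanningTree_of_mem_outputLaw htop hT).weight_le fun u v h => (hV u v h).2)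
        · refine le_trans ?_ le_self_add
          refine (expect_outputLaw_le (by linarith) htop
            (dist_le_of_notMem_badDelays htop (by linarith) hδ) hS.connects hS1 r₁ r₂).trans ?_
          push_cast
          exact le_rfl
    _ = (ENNReal.ofReal (weight S) + ∑ j ∈ Finset.range (K + 1),
        ENNReal.ofReal (α ^ (j + 1)) * ((3 / 4) ^ r₁ * (2 * ∫⁻ δ, c j δ ∂(delayLaw (levelRate α ρ)))
          + ∫⁻ δ, c (j + 2) δ ∂(delayLaw (levelRate α ρ)) +
          (3 / 4) ^ r₂ * ∫⁻ δ, c' j δ ∂(delayLaw (levelRate α ρ)))) +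
          ENNReal.ofReal ((Fintype.card V - 1) * W) *
            delayLaw (levelRate α ρ : Fin (K + 1) × V → ℝ) (badDelays α) := by
        have m1 : ∀ j, AEMeasurable (fun δ => (3 / 4) ^ r₁ * (2 * c j δ))
            (delayLaw (levelRate α ρ)) := fun j => ((hc j).const_mul 2).const_mul _
        have m2 : ∀ j, AEMeasurable (fun δ => (3 / 4) ^ r₂ * c' j δ)
            (delayLaw (levelRate α ρ)) := fun j => (hc' j).const_mul _
        have m3 : ∀ j, AEMeasurable (fun δ => (3 / 4) ^ r₁ * (2 * c j δ) + c (j + 2) δ +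
          (3 / 4) ^ r₂ * c' j δ) (delayLaw (levelRate α ρ)) := fun j =>
            ((m1 j).add (hc (j + 2))).add (m2 j)
        rw [lintegral_add_right _ (measurable_const.indicator (measurableSet_badDelays α)),
          lintegral_indicator_const (measurableSet_badDelays α),
          lintegral_add_left measurable_const, lintegral_const, measure_univ, mul_one,
          lintegral_finsetSum' _ fun j _ => (m3 j).const_mul _]
        congr 2
        refine Finset.sum_congr rfl fun j _ => ?_
        rw [lintegral_const_mul'' _ (m3 j), lintegral_add_right' _ (m2 j),
          lintegral_add_right' _ (hc (j + 2)), lintegral_const_mul'' _ ((hc j).const_mul 2),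
          lintegral_const_mul'' _ (hc j), lintegral_const_mul'' _ (hc' j)]
    _ ≤ _ := by
        gcongr
        · have hterm : ∀ j ∈ Finset.range (K + 1), ENNReal.ofReal (α ^ (j + 1)) *
              ((3 / 4) ^ r₁ * (2 * ∫⁻ δ, c j δ ∂(delayLaw (levelRate α ρ)))
                + ∫⁻ δ, c (j + 2) δ ∂(delayLaw (levelRate α ρ)) +
                (3 / 4) ^ r₂ * ∫⁻ δ, c' j δ ∂(delayLaw (levelRate α ρ))) ≤
              ENNReal.ofReal (weight S * ((3 / 4) ^ r₁ * (12 * ρ * α) + 6 * ρ / α +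
                (3 / 4) ^ r₂ * (6 * ρ * α ^ 2 + α))) := by
            intro j _
            rw [mul_add, mul_left_comm _ ((3 / 4 : ℝ≥0∞) ^ r₂)]
            calc _ ≤ ENNReal.ofReal (α ^ (j + 1)) * (ENNReal.ofReal ((3 / 4) ^ r₁) *
                  (ENNReal.ofReal 2 * ENNReal.ofReal (6 * ρ * weight S / α ^ j)) +
                  ENNReal.ofReal (6 * ρ * weight S / α ^ (j + 2))) +
                  ENNReal.ofReal ((3 / 4) ^ r₂) *
                    ENNReal.ofReal (weight S * (6 * ρ * α ^ 2 + α)) := by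
                  rw [three_quarters_pow, three_quarters_pow, ENNReal.ofReal_ofNat]
                  gcongr
                  · exact hci j
                  · exact hci (j + 2)
                  · exact hci' j
              _ = _ := by
                  rw [← ENNReal.ofReal_mul (by positivity), ← ENNReal.ofReal_mul (by positivity),
                    ← ENNReal.ofReal_add (by positivity) (by positivity),
                    ← ENNReal.ofReal_mul (by positivity), ← ENNReal.ofReal_mul (by positivity),
                    ← ENNReal.ofReal_add (by positivity) (by positivity)]
                  congr 1
                  field_simp
                  ring
          refine (Finset.sum_le_sum hterm).trans (le_of_eq ?_)
          rw [Finset.sum_const, Finset.card_range, nsmul_eq_mul,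
            ENNReal.ofReal_mul (by positivity : (0 : ℝ) ≤ K + 1), ← ENNReal.ofReal_natCast]
          push_cast
          rfl
        · exact measure_badDelays_le hα0 hρ

end Integration

end MetricMST

namespace MetricMST

open scoped ENNReal
open MeasureTheory ProbabilityTheory

/-! ### Choice of the constants. -/

section Parameters

/-- The number of levels is at most logarithmic. -/
lemma topLevel_add_one_le {a n : ℕ} {α W : ℝ} (hn : 1 ≤ Real.log n) (hα : 3 ≤ α) (hW : 1 ≤ W)
    (hWn : W ≤ (n : ℝ) ^ a) : (topLevel α W : ℝ) + 1 ≤ (a + 3) * Real.log n := by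
  have hα1 : 1 ≤ Real.log α := by
    rw [Real.le_log_iff_exp_le (by linarith)]
    linarith [Real.exp_one_lt_d9]
  have h0 : 0 ≤ Real.logb α W := Real.logb_nonneg (by linarith) hW
  have h1 : Real.logb α W ≤ a * Real.log n := by
    rw [Real.logb, ← Real.log_pow]
    exact (div_le_self (Real.log_nonneg hW) hα1).trans (Real.log_le_log (by linarith) hWn)
  have h2 := (Nat.ceil_lt_add_one h0).le
  unfold topLevel
  nlinarith

lemma le_pow_topLevel {α W : ℝ} (hα : 1 < α) (hW : 0 < W) : W ≤ α ^ topLevel α W := by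
  rw [← Real.rpow_natCast, ← Real.logb_le_iff_le_rpow hα hW]
  exact Nat.le_ceil _

/-- Exponential decay beats any fixed polynomial after logarithmically many rounds. -/
lemma three_quarters_pow_mul_le {C ℓ y R : ℝ} {r : ℕ} (hC : 1 ≤ C) (hℓ : 0 < ℓ) (hy : 0 < y)
    (hy' : ℓ ≤ Real.log y) (hR : R = (7 + Real.log C / ℓ) / Real.log (4 / 3))
    (hr : R * Real.log y ≤ r) : (3 / 4 : ℝ) ^ r * (C * y ^ 7) ≤ 1 := by
  have hC' := Real.log_nonneg hC
  have h43 : 0 < Real.log (4 / 3) := Real.log_pos (by norm_num)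
  have h1 : (7 + Real.log C / ℓ) * Real.log y ≤ r * Real.log (4 / 3) := by
    have h := mul_le_mul_of_nonneg_right hr h43.le
    rw [hR] at h
    calc _ = (7 + Real.log C / ℓ) / Real.log (4 / 3) * Real.log y * Real.log (4 / 3) := by
          field_simp
      _ ≤ _ := h
  have h2 : Real.log C ≤ Real.log C / ℓ * Real.log y := by
    rw [div_mul_eq_mul_div, le_div_iff₀ hℓ]
    exact mul_le_mul_of_nonneg_left hy' hC'
  have h3 : Real.log ((3 / 4 : ℝ) ^ r * (C * y ^ 7)) ≤ 0 := by
    rw [Real.log_mul (by positivity) (by positivity), Real.log_mul (by positivity) (by positivity),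
      Real.log_pow, Real.log_pow]
    have h4 : Real.log (3 / 4) = -Real.log (4 / 3) := by
      rw [← Real.log_inv]; norm_num
    rw [h4]
    push_cast
    linarith
  exact (Real.log_nonpos_iff (by positivity)).1 h3

lemma main_cost_le {A c L ε α A₁ κ q₁ q₂ : ℝ} (hA : 3 ≤ A) (hc : 1 ≤ c) (hL : 1 ≤ L) (hε : 0 < ε)
    (hε1 : ε ≤ 1) (hA₁ : 1 ≤ A₁) (hα : 1 ≤ α) (hαl : 24 * c * A * L ^ 2 / ε ≤ α)
    (hαu : α ≤ A₁ * L ^ 2 / ε) (hκ : κ ≤ A * L) (hq₁0 : 0 ≤ q₁) (hq₂0 : 0 ≤ q₂)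
    (hq₁ : q₁ * (48 * c * A * A₁ ^ 2 * (L / ε) ^ 7) ≤ 1)
    (hq₂ : q₂ * (48 * c * A * A₁ ^ 2 * (L / ε) ^ 7) ≤ 1) :
    κ * (q₁ * (12 * (c * L) * α) + 6 * (c * L) / α + q₂ * (6 * (c * L) * α ^ 2 + α)) ≤
      3 / 4 * ε := by
  set y := L / ε with hy
  have hLy : L = y * ε := by rw [hy]; field_simp
  have hy1 : 1 ≤ y := by rw [hy, le_div_iff₀ hε]; linarith
  have hα0 : 0 < α := by linarith
  have hcA : 0 < c * A := by nlinarith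
  have hLle : L ≤ y := by rw [hLy]; nlinarith
  have hαy : α ≤ A₁ * (y * L) := by
    refine hαu.trans (le_of_eq ?_)
    rw [hy]; field_simp
  -- The only term without a decaying factor; it dictates the lower bound on `α`.
  have t1 : A * L * (6 * (c * L) / α) ≤ ε / 4 := by
    rw [div_le_iff₀ hε] at hαl
    rw [← mul_div_assoc, div_le_iff₀ hα0]
    nlinarith
  have t2 : A * L * (q₁ * (12 * (c * L) * α)) ≤ ε / 4 := by
    calc A * L * (q₁ * (12 * (c * L) * α)) = q₁ * (12 * c * A) * (L ^ 2 * α) := by ring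
      _ ≤ q₁ * (12 * c * A) * (L ^ 2 * (A₁ * (y * L))) := by
          gcongr
      _ = q₁ * (12 * c * A * A₁ * (L ^ 2 * y ^ 2)) * ε := by rw [hLy]; ring
      _ ≤ q₁ * (12 * c * A * A₁ ^ 2 * y ^ 7) * ε := by
          gcongr
          · nlinarith
          · calc L ^ 2 * y ^ 2 ≤ y ^ 2 * y ^ 2 := by gcongr
              _ = y ^ 4 := by ring
              _ ≤ y ^ 7 := pow_le_pow_right₀ hy1 (by norm_num)
      _ = q₁ * (48 * c * A * A₁ ^ 2 * y ^ 7) * (ε / 4) := by ring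
      _ ≤ 1 * (ε / 4) := by gcongr
      _ = ε / 4 := one_mul _
  have t3 : A * L * (q₂ * (6 * (c * L) * α ^ 2 + α)) ≤ ε / 4 := by
    have h1 : α ≤ c * L * α ^ 2 := by
      have : 1 ≤ c * L := by nlinarith
      nlinarith [mul_pos hα0 hα0]
    calc A * L * (q₂ * (6 * (c * L) * α ^ 2 + α))
        ≤ A * L * (q₂ * (6 * (c * L) * α ^ 2 + c * L * α ^ 2)) := by gcongr
      _ = q₂ * (7 * c * A) * (L ^ 2 * α ^ 2) := by ring
      _ ≤ q₂ * (7 * c * A) * (L ^ 2 * (A₁ * (y * L)) ^ 2) := by gcongr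
      _ = q₂ * (7 * c * A * A₁ ^ 2 * (L ^ 3 * y ^ 3)) * ε := by rw [hLy]; ring
      _ ≤ q₂ * (12 * c * A * A₁ ^ 2 * y ^ 7) * ε := by
          gcongr
          · norm_num
          · calc L ^ 3 * y ^ 3 ≤ y ^ 3 * y ^ 3 := by gcongr
              _ = y ^ 6 := by ring
              _ ≤ y ^ 7 := pow_le_pow_right₀ hy1 (by norm_num)
      _ = q₂ * (48 * c * A * A₁ ^ 2 * y ^ 7) * (ε / 4) := by ring
      _ ≤ 1 * (ε / 4) := by gcongr
      _ = ε / 4 := one_mul _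
  have hκ' : κ * (q₁ * (12 * (c * L) * α) + 6 * (c * L) / α + q₂ * (6 * (c * L) * α ^ 2 + α)) ≤
      A * L * (q₁ * (12 * (c * L) * α) + 6 * (c * L) / α + q₂ * (6 * (c * L) * α ^ 2 + α)) := by
    gcongr
  linarith

/-- The exponent `2 a + b + 6` collects `n ^ 2 ≥ 4`, `W ≤ n ^ a`, `κ ≤ n ^ (a + 3)`, one factor `n`
and `1 ≤ ε n ^ b`. The factor `n - 1` is absorbed by `w`. -/
lemma bad_cost_le {a b n : ℕ} {c ε W κ w : ℝ} (hn : 2 ≤ n) (hc : 2 * (2 * a + b + 6) ≤ c)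
    (hε : 1 / (n : ℝ) ^ b ≤ ε) (hW0 : 0 ≤ W) (hW : W ≤ (n : ℝ) ^ a) (hκ0 : 0 ≤ κ)
    (hκ : κ ≤ (a + 3) * Real.log n) (hw : (n : ℝ) - 1 ≤ w) :
    (n - 1) * W * (κ * n * Real.exp (-(c * Real.log n / 2))) ≤ 1 / 4 * ε * w := by
  have hn2 : (2 : ℝ) ≤ n := by exact_mod_cast hn
  have hn0 : (0 : ℝ) < n := by linarith
  have hlog0 : 0 ≤ Real.log n := Real.log_nonneg (by linarith)
  have hlog : Real.log n ≤ n := Real.log_le_self hn0.le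
  have ha : ((a : ℝ) + 3) ≤ (n : ℝ) ^ (a + 2) := by
    have h1 : a + 3 ≤ 2 ^ (a + 2) := by
      have := Nat.lt_two_pow_self (n := a + 2)
      omega
    calc ((a : ℝ) + 3) ≤ 2 ^ (a + 2) := by exact_mod_cast h1
      _ ≤ _ := by gcongr
  have hexp : Real.exp (-(c * Real.log n / 2)) * (n : ℝ) ^ (2 * a + b + 6) ≤ 1 := by
    have h1 : (n : ℝ) ^ (2 * a + b + 6) = Real.exp ((2 * a + b + 6) * Real.log n) := by
      rw [← Real.rpow_natCast, Real.rpow_def_of_pos hn0]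
      push_cast
      ring_nf
    rw [h1, ← Real.exp_add, Real.exp_le_one_iff]
    nlinarith
  have hε' : 1 ≤ ε * (n : ℝ) ^ b := by rwa [div_le_iff₀ (by positivity)] at hε
  have h4 : (4 : ℝ) ≤ (n : ℝ) ^ 2 := by nlinarith
  set E := Real.exp (-(c * Real.log n / 2)) with hE
  have hE0 : 0 < E := Real.exp_pos _
  have key : 4 * (W * (κ * n * E)) ≤ ε := by
    calc 4 * (W * (κ * n * E)) ≤
          (n : ℝ) ^ 2 * ((n : ℝ) ^ a * ((((n : ℝ) ^ (a + 2)) * n) * n * E)) := by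
          gcongr
          exact hκ.trans (mul_le_mul ha hlog hlog0 (by positivity))
      _ = E * (n : ℝ) ^ (2 * a + 6) := by ring
      _ ≤ E * (n : ℝ) ^ (2 * a + 6) * (ε * (n : ℝ) ^ b) :=
          le_mul_of_one_le_right (by positivity) hε'
      _ = E * (n : ℝ) ^ (2 * a + b + 6) * ε := by ring
      _ ≤ 1 * ε := by
          gcongr
          exact le_trans (by positivity) hε
      _ = ε := one_mul _
  have h5 : 0 ≤ W * (κ * n * E) := by positivity
  calc (n - 1) * W * (κ * n * E) = (n - 1) * (W * (κ * n * E)) := by ring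
    _ ≤ w * (W * (κ * n * E)) := by gcongr
    _ ≤ w * (1 / 4 * ε) := by
        refine mul_le_mul_of_nonneg_left (by linarith) (le_trans ?_ hw)
        linarith
    _ = _ := by ring

end Parameters

/-! ### The case of two points. -/

section TwoPoints

variable {V : Type*} [Fintype V] [MetricSpace V]

lemma weight_le_of_card_eq_two (hV : Fintype.card V = 2) {S T : Finset (Sym2 V)}
    (hS : IsSpanningTree S) (hT : IsSpanningTree T) : weight T ≤ weight S := by
  classical
  obtain ⟨x, y, hxy, huniv⟩ := Finset.card_eq_two.1 (Finset.card_univ.trans hV)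
  have key : ∀ R : Finset (Sym2 V), IsSpanningTree R → R = {s(x, y)} := by
    intro R hR
    have h1 : R ⊆ {s(x, y)} := by
      intro e he
      induction e using Sym2.inductionOn with
      | hf u v =>
        have huv : u ≠ v := fun h => hR.1 _ he h
        have hu : u ∈ ({x, y} : Finset V) := huniv ▸ Finset.mem_univ u
        have hv : v ∈ ({x, y} : Finset V) := huniv ▸ Finset.mem_univ v
        simp only [Finset.mem_insert, Finset.mem_singleton] at hu hv ⊢
        rw [Sym2.eq_iff]
        grind
    refine Finset.eq_of_subset_of_card_le h1 ?_
    have := hR.card_add_one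
    rw [Finset.card_singleton]
    omega
  rw [key S hS, key T hT]

end TwoPoints

end MetricMST

open MetricMST in
theorem lemma4p1 (a b : ℕ) :
    ∃ c₀ : ℝ, 0 < c₀ ∧ ∀ c : ℝ, c₀ ≤ c →
    ∃ A₀ : ℝ, 0 < A₀ ∧ ∀ A₁ : ℝ, A₀ ≤ A₁ →
    ∃ R₀ : ℝ, 0 < R₀ ∧
    ∀ (V : Type*) [Fintype V] [Nonempty V] [MetricSpace V] (n : ℕ) (W ε α : ℝ) (r₁ r₂ : ℕ)
      (σ : MetricMST.Choices V),
      n = Fintype.card V → 2 ≤ n →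
      (∀ u v : V, u ≠ v → 1 ≤ dist u v ∧ dist u v ≤ W) → W ≤ (n : ℝ) ^ a →
      1 / (n : ℝ) ^ b ≤ ε → ε ≤ 1 →
      A₀ * Real.log n ^ 2 / ε ≤ α → α ≤ A₁ * Real.log n ^ 2 / ε →
      R₀ * (Real.log (1 / ε) + Real.log (Real.log n)) ≤ r₁ →
      R₀ * (Real.log (1 / ε) + Real.log (Real.log n)) ≤ r₂ →
      (∀ (δ : Fin (MetricMST.topLevel α W + 1) × V → ℝ) (T : Finset (Sym2 V)),
        T ∈ (MetricMST.outputLaw σ α r₁ r₂ δ).support → MetricMST.IsSpanningTree T) ∧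
      MeasureTheory.Integrable
        (fun δ : Fin (MetricMST.topLevel α W + 1) × V → ℝ => MetricMST.meanWeight σ α r₁ r₂ δ)
        (MetricMST.delayMeasure V α c (MetricMST.topLevel α W)) ∧
      ∀ S : Finset (Sym2 V), MetricMST.IsMinSpanningTree S →
        ∫ δ : Fin (MetricMST.topLevel α W + 1) × V → ℝ, MetricMST.meanWeight σ α r₁ r₂ δ
            ∂(MetricMST.delayMeasure V α c (MetricMST.topLevel α W)) ≤
          (1 + ε) * MetricMST.weight S := by
  refine ⟨2 * (2 * a + b + 6), by positivity, fun c hc => ?_⟩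
  have hc12 : 12 ≤ c := by
    have h1 : (0 : ℝ) ≤ a := Nat.cast_nonneg a
    have h2 : (0 : ℝ) ≤ b := Nat.cast_nonneg b
    linarith
  set A : ℝ := a + 3 with hA
  have hA3 : 3 ≤ A := by
    have h1 : (0 : ℝ) ≤ a := Nat.cast_nonneg a
    linarith
  have hcA : 36 ≤ c * A := by nlinarith
  refine ⟨24 * c * A, by positivity, fun A₁ hA₁ => ?_⟩
  have hA₁1 : 1 ≤ A₁ := by nlinarith
  set C : ℝ := 48 * c * A * A₁ ^ 2 with hC
  have hC1 : 1 ≤ C := by nlinarith [one_le_pow₀ hA₁1 (n := 2)]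
  have hlog3 : 1 < Real.log 3 := by
    rw [Real.lt_log_iff_exp_lt (by norm_num)]
    linarith [Real.exp_one_lt_d9]
  have hℓ : 0 < Real.log (Real.log 3) := Real.log_pos hlog3
  -- For `n ≥ 3` the logarithm of `log n / ε` is at least `log (log 3) > 0`, so a multiple of it
  -- absorbs `log C`.
  refine ⟨(7 + Real.log C / Real.log (Real.log 3)) / Real.log (4 / 3), ?_, ?_⟩
  · have h1 := Real.log_nonneg hC1
    have h2 : 0 < Real.log (4 / 3) := Real.log_pos (by norm_num)
    positivity
  intro V _ _ _ n W ε α r₁ r₂ σ hnV hn hV hW hε hε1 hαl hαu hr₁ hr₂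
  have hn2 : (2 : ℝ) ≤ n := by exact_mod_cast hn
  have hε0 : 0 < ε := lt_of_lt_of_le (by positivity) hε
  have hL0 : 1 / 2 < Real.log n :=
    lt_of_lt_of_le (by linarith [Real.log_two_gt_d9]) (Real.log_le_log two_pos hn2)
  have hα3 : 3 ≤ α := by
    refine le_trans ?_ hαl
    rw [le_div_iff₀ hε0]
    have h1 : 1 / 4 ≤ Real.log n ^ 2 := by nlinarith
    nlinarith
  obtain ⟨x, y, hxy⟩ : ∃ x y : V, x ≠ y :=
    Fintype.exists_pair_of_one_lt_card (by omega)
  have hW1 : 1 ≤ W := (hV x y hxy).1.trans (hV x y hxy).2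
  have htop : ∀ u v : V, dist u v ≤ α ^ topLevel α W := by
    intro u v
    by_cases huv : u = v
    · subst huv
      rw [dist_self]
      positivity
    · exact (hV u v huv).2.trans (le_pow_topLevel (by linarith) (by linarith))
  have hρ : 0 < c * Real.log n := mul_pos (by linarith) (by linarith)
  have hrate : ∀ p : Fin (topLevel α W + 1) × V, 0 < levelRate α (c * Real.log n) p := fun p => by
    unfold levelRate; positivity
  have hlaw : delayMeasure V α c (topLevel α W) = delayLaw (levelRate α (c * Real.log n)) := by
    subst hnV
    rfl
  have hprob := fun p => ProbabilityTheory.isProbabilityMeasure_expMeasure (hrate p)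
  rw [hlaw]
  refine ⟨fun δ T hT => isSpanningTree_of_mem_outputLaw htop hT,
    integrable_meanWeight hrate r₁ r₂, fun S hS => ?_⟩
  have hS1 := card_le_weight (hS.1.one_le_edgeWeight fun u v h => (hV u v h).1)
  have hScard : (S.card : ℝ) = n - 1 := by
    have h1 : (S.card : ℝ) + 1 = n := by
      rw [hnV]
      exact_mod_cast hS.1.card_add_one
    linarith
  rw [hScard] at hS1
  have hw0 := weight_nonneg S
  rw [MeasureTheory.integral_eq_lintegral_of_nonneg_ae
    (Filter.Eventually.of_forall fun δ => meanWeight_nonneg δ r₁ r₂)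
    (integrable_meanWeight hrate r₁ r₂).aestronglyMeasurable]
  refine ENNReal.toReal_le_of_le_ofReal (by positivity) ?_
  simp only [ofReal_meanWeight]
  -- For `n = 2`, `log (log n)` is negative and the hypothesis on the rounds may be void, but there
  -- is only one spanning tree.
  rcases Nat.eq_or_lt_of_le hn with hn' | hn3
  · calc _ ≤ ∫⁻ _, ENNReal.ofReal (weight S)
          ∂(delayLaw (levelRate α (c * Real.log n) : Fin (topLevel α W + 1) × V → ℝ)) :=
          MeasureTheory.lintegral_mono fun δ => expect_le_of_le fun T hT =>
            ENNReal.ofReal_le_ofReal (weight_le_of_card_eq_two (by omega) hS.1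
              (isSpanningTree_of_mem_outputLaw htop hT))
      _ = ENNReal.ofReal (weight S) := by
          rw [MeasureTheory.lintegral_const, MeasureTheory.measure_univ, mul_one]
      _ ≤ _ := ENNReal.ofReal_le_ofReal (by nlinarith)
  · have hn3' : (3 : ℝ) ≤ n := by exact_mod_cast hn3
    have hlog : Real.log 3 ≤ Real.log n := Real.log_le_log (by norm_num) hn3'
    have hL1 : 1 ≤ Real.log n := by linarith
    have hκ := topLevel_add_one_le hL1 hα3 hW1 hW
    have hy : Real.log (1 / ε) + Real.log (Real.log n) = Real.log (Real.log n / ε) := by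
      rw [← Real.log_mul (by positivity) (by linarith)]
      congr 1
      ring
    rw [hy] at hr₁ hr₂
    have hy' : Real.log (Real.log 3) ≤ Real.log (Real.log n / ε) := by
      refine Real.log_le_log (by linarith) (hlog.trans ?_)
      rw [le_div_iff₀ hε0]
      nlinarith
    have hy0 : 0 < Real.log n / ε := by positivity
    have hmain := main_cost_le (κ := (topLevel α W : ℝ) + 1) hA3 (by linarith) hL1 hε0 hε1 hA₁1
      (by linarith) hαl hαu hκ (by positivity) (by positivity)
      (three_quarters_pow_mul_le hC1 hℓ hy0 hy' rfl hr₁)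
      (three_quarters_pow_mul_le hC1 hℓ hy0 hy' rfl hr₂)
    have hbad := bad_cost_le (κ := (topLevel α W : ℝ) + 1) hn hc hε (by linarith) hW
      (by positivity) hκ hS1
    refine (lintegral_expect_outputLaw_le (by linarith) hρ htop hV hS.1 r₁ r₂).trans ?_
    have hn1 : (0 : ℝ) ≤ n - 1 := by linarith
    rw [← hnV, ← ENNReal.ofReal_mul (by positivity), ← ENNReal.ofReal_add hw0 (by positivity),
      ← ENNReal.ofReal_add (by positivity) (by positivity)]
    refine ENNReal.ofReal_le_ofReal ?_
    have hmain' := mul_le_mul_of_nonneg_left hmain hw0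
    have h1 : ∀ z : ℝ, ((topLevel α W : ℝ) + 1) * (weight S * z) =
        weight S * (((topLevel α W : ℝ) + 1) * z) := fun z => by ring
    rw [h1]
    linarith
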